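/- **Setting.** Let $\mathcal R$ be the differential algebra over $\mathbb C$, with commuting derivations $\partial_1,\partial_2$, freely generated by unknowns $a_{1,i},a_{2,i}$ ($i\ge 1$) and $\beta$, with $e^{\pm\beta}$ adjoined: $\mathcal R$ is the algebra of Laurent polynomials in $e^{\beta}$ over the polynomial ring in all $\partial_1^m\partial_2^n a_{\nu,i}$ and $\partial_1^m\partial_2^n\beta$ ($m,n\ge0$), and $\partial_\nu e^\beta=e^\beta\,\partial_\nu\beta$. Let $\mathcal E$ be the algebra of operators $\sum_{i\le m}\sum_{j\le n}f_{ij}\partial_1^i\partial_2^j$ with $f_{ij}\in\mathcal R$, $m,n\in\mathbb Z$, and product $$f\partial_1^i\partial_2^j\cdot g\,\partial_1^p\partial_2^q=\sum_{r,s\ge0}\binom ir\binom js f\,\partial_1^r\partial_2^s(g)\,\partial_1^{i+p-r}\partial_2^{j+q-s}.$$ For $A=\sum_i f_i\partial_\nu^i$ put $A_{\ge m}=\sum_{i\ge m}f_i\partial_\nu^i$ and $A_{<m}=\sum_{i<m}f_i\partial_\nu^i$. For a differential operator $D$ let $D\langle A\rangle$ be obtained by applying $D$ to each coefficient of $A$;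 derivations of $\mathcal R$ also act on operators coefficientwise. Put $$\Phi_1=1+\sum_{i\ge1}a_{1,i}\partial_1^{-i},\qquad \Phi_2=e^\beta\Big(1+\sum_{i\ge1}a_{2,i}\partial_2^{-i}\Big),\qquad P_\nu=\Phi_\nu\partial_\nu\Phi_\nu^{-1}.$$ For $\nu\in\{1,2\}$ and $k\ge1$, the flow $\partial/\partial t_{\nu,k}$ is to be a $\mathbb C$-linear derivation of $\mathcal R$ that commutes with $\partial_1$ and $\partial_2$, satisfies $\frac{\partial e^\beta}{\partial t_{\nu,k}}=e^\beta\frac{\partial\beta}{\partial t_{\nu,k}}$, and obeys $$\frac{\partial\Phi_1}{\partial t_{1,k}}=-(P_1^k)_{<0}\Phi_1,\quad \frac{\partial\Phi_2}{\partial t_{2,k}}=-(P_2^k)_{<1}\Phi_2,\quad \frac{\partial\Phi_1}{\partial t_{2,k}}=(P_2^k)_{\ge1}\langle\Phi_1\rangle,\quad \frac{\partial\Phi_2}{\partial t_{1,k}}=(P_1^k)_{\ge0}\langle\Phi_2\rangle .\tag{1}$$ The constraint is $$e^\beta\partial_1e^{-\beta}\Phi_1\partial_2\Phi_1^{-1}=\partial_2\Phi_2\partial_1\Phi_2^{-1},\tag{2}$$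 and $\mathcal I\subset\mathcal R$ denotes the differential ideal generated by the coefficients of the difference of its two sides, so that $\mathcal R/\mathcal I$ is the algebra of differential polynomials in unknowns subject to (2). Finally, set $$B_{\nu,k}^\mu=\begin{cases}-(P_\nu^k)_{<\nu-1},&\mu=\nu,\\ (P_\nu^k)_{\ge\nu-1}\langle\Phi_\mu\rangle\Phi_\mu^{-1},&\mu\ne\nu.\end{cases}$$ **Theorem 3.1.** The system (1)–(2) (the KP-mKP hierarchy) is well defined and compatible, that is: 1. $\Phi_1$ and $\Phi_2$ are invertible in $\mathcal E$, and $P_\nu^k$ contains only powers of $\partial_\nu$, for $\nu\in\{1,2\}$ and $k\ge1$. 2. For all $\nu\in\{1,2\}$ and $k\ge1$ there is exactly one flow $\partial/\partial t_{\nu,k}$ on $\mathcal R$. 3. The constraint is preserved by every flow: $\frac{\partial}{\partial t_{\nu,k}}\mathcal I\subseteq\mathcal I$ for all $\nu\in\{1,2\}$, $k\ge1$. 4. Under the constraint all flows commute: $\big[\frac{\partial}{\partial t_{\mu,k}},\frac{\partial}{\partial t_{\nu,l}}\big]\mathcal R\subseteq\mathcal I$ for all $\mu,\nu\in\{1,2\}$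 and $k,l\ge1$. Moreover, for all $\lambda,\mu,\nu\in\{1,2\}$ and $k,l\ge1$, $$\frac{\partial B_{\nu,l}^\lambda}{\partial t_{\mu,k}}-\frac{\partial B_{\mu,k}^\lambda}{\partial t_{\nu,l}}+\big[B_{\nu,l}^\lambda,B_{\mu,k}^\lambda\big]=0$$ under the constraint, i.e. all coefficients of the left-hand side lie in $\mathcal I$. -/

import Mathlib

noncomputable section

namespace KPmKP

/-- A commutative `ℂ`-algebra with two commuting derivations `∂₁ = d 0` and `∂₂ = d 1`.
Throughout, the index set `{1, 2}` is `Fin 2`, with `0` standing for `1` and `1` for `2`. -/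
class BiDifferential (B : Type*) [CommRing B] [Algebra ℂ B] where
  d : Fin 2 → Derivation ℂ B B
  d_comm : ∀ f : B, d 0 (d 1 f) = d 1 (d 0 f)

/-- The iterated derivative `∂₁^(r 0) ∂₂^(r 1) f`. -/
def dpow {B : Type*} [CommRing B] [Algebra ℂ B] [BiDifferential B] (r : Fin 2 → ℕ) (f : B) : B :=
  (BiDifferential.d (B := B) 0)^[r 0] ((BiDifferential.d (B := B) 1)^[r 1] f)

/-- Pseudo-differential operators `∑_{i ≤ m} ∑_{j ≤ n} f_{ij} ∂₁^i ∂₂^j` with two derivations;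
`coeff α` is the coefficient of `∂₁^(α 0) ∂₂^(α 1)`. -/
@[ext]
structure PDO (B : Type*) [Zero B] where
  coeff : (Fin 2 → ℤ) → B
  bdd : ∃ N : Fin 2 → ℤ, ∀ α, coeff α ≠ 0 → α ≤ N

namespace PDO

section Linear

variable {B : Type*} [CommRing B]

/-- The operator `f ∂₁^(α 0) ∂₂^(α 1)`. -/
def mono (f : B) (α : Fin 2 → ℤ) : PDO B where
  coeff γ := if γ = α then f else 0
  bdd := ⟨α, fun γ h => by
    by_cases hγ : γ = α
    · exact hγ.le
    · simp [hγ] at h⟩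

/-- The operator of multiplication by `f`. -/
def fn (f : B) : PDO B := mono f 0

/-- The operator `∂_ν`. -/
def del (ν : Fin 2) : PDO B := mono 1 (Pi.single ν 1)

/-- The operator `∑_{n ≥ 0} f_n ∂_ν^{-n}`. -/
def series (ν : Fin 2) (f : ℕ → B) : PDO B where
  coeff α := if α ν ≤ 0 ∧ ∀ κ, κ ≠ ν → α κ = 0 then f (-α ν).toNat else 0
  bdd := ⟨0, fun α h => by
    by_cases hα : α ν ≤ 0 ∧ ∀ κ, κ ≠ ν → α κ = 0
    · intro κ
      by_cases hκ : κ = ν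
      · subst hκ; exact hα.1
      · exact (hα.2 κ hκ).le
    · exact absurd (if_neg hα) h⟩

instance : One (PDO B) := ⟨fn 1⟩

instance : Neg (PDO B) where
  neg A :=
    { coeff := fun α => -A.coeff α
      bdd := by
        obtain ⟨N, hN⟩ := A.bdd
        exact ⟨N, fun α h => hN α (by simpa using h)⟩ }

instance : Add (PDO B) where
  add A C :=
    { coeff := fun α => A.coeff α + C.coeff α
      bdd := by
        obtain ⟨N, hN⟩ := A.bdd
        obtain ⟨M, hM⟩ := C.bdd
        refine ⟨N ⊔ M, fun α h => ?_⟩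
        by_cases hA : A.coeff α = 0
        · exact (hM α (by simpa [hA] using h)).trans le_sup_right
        · exact (hN α hA).trans le_sup_left }

instance : Sub (PDO B) := ⟨fun A C => A + -C⟩

/-- The truncation `A_{≥ m}` with respect to the powers of `∂_ν`. -/
def truncGE (ν : Fin 2) (m : ℤ) (A : PDO B) : PDO B where
  coeff α := if m ≤ α ν then A.coeff α else 0
  bdd := by
    obtain ⟨N, hN⟩ := A.bdd
    exact ⟨N, fun α h => hN α fun h0 => h (by simp [h0])⟩

/-- The truncation `A_{< m}` with respect to the powers of `∂_ν`. -/
def truncLT (ν : Fin 2) (m : ℤ) (A : PDO B) : PDO B where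
  coeff α := if α ν < m then A.coeff α else 0
  bdd := by
    obtain ⟨N, hN⟩ := A.bdd
    exact ⟨N, fun α h => hN α fun h0 => h (by simp [h0])⟩

/-- `A` contains only powers of `∂_ν`. -/
def IsSingle (ν : Fin 2) (A : PDO B) : Prop :=
  ∀ α, A.coeff α ≠ 0 → ∀ κ, κ ≠ ν → α κ = 0

/-- A derivation of the coefficient algebra applied to every coefficient of an operator. -/
def mapCoeff [Algebra ℂ B] (T : Derivation ℂ B B) (A : PDO B) : PDO B where
  coeff α := T (A.coeff α)
  bdd := by
    obtain ⟨N, hN⟩ := A.bdd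
    exact ⟨N, fun α h => hN α fun h0 => h (by simp [h0])⟩

end Linear

section Product

variable {B : Type*} [CommRing B] [Algebra ℂ B] [BiDifferential B]

lemma dpow_zero_arg (r : Fin 2 → ℕ) : dpow r (0 : B) = 0 := by
  simp [dpow, iterate_map_zero]

/-- The product determined by
`f ∂^α · g ∂^δ = ∑_{r ≥ 0} binom(α 0, r 0) binom(α 1, r 1) f ∂^r(g) ∂^(α + δ - r)`:
the coefficient of `∂^γ` collects the terms with `δ = γ - α + r`.
Only finitely many of them are nonzero. -/
instance : Mul (PDO B) where
  mul A C :=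
    { coeff := fun γ => ∑ᶠ p : (Fin 2 → ℤ) × (Fin 2 → ℕ),
        (Ring.choose (p.1 0) (p.2 0) * Ring.choose (p.1 1) (p.2 1)) •
          (A.coeff p.1 * dpow p.2 (C.coeff fun ν => γ ν - p.1 ν + p.2 ν))
      bdd := by
        obtain ⟨N, hN⟩ := A.bdd
        obtain ⟨M, hM⟩ := C.bdd
        refine ⟨N + M, fun γ h => ?_⟩
        obtain ⟨p, hp⟩ := not_forall.mp fun h0 => h (finsum_eq_zero_of_forall_eq_zero h0)
        have hA : A.coeff p.1 ≠ 0 := fun h0 => hp (by simp [h0])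
        have hC : C.coeff (fun ν => γ ν - p.1 ν + p.2 ν) ≠ 0 := fun h0 =>
          hp (by simp [h0, dpow_zero_arg])
        intro ν
        have h1 := hN _ hA ν
        have h2 := hM _ hC ν
        simp only [Pi.add_apply] at *
        omega }

/-- Powers, with `A ^ 0 = 1` and `A ^ (k + 1) = A ^ k * A`. -/
instance : Pow (PDO B) ℕ := ⟨fun A k => Nat.rec 1 (fun _ X => X * A) k⟩

/-- The two-sided inverse of an invertible operator (an arbitrary operator otherwise). -/
instance : Inv (PDO B) where
  inv A := @Classical.epsilon (PDO B) ⟨1⟩ fun C => A * C = 1 ∧ C * A = 1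

/-- The action `D⟨A⟩` of a differential operator `D = ∑_{r ≥ 0} g_r ∂^r` on the coefficients
of `A`. -/
def act (D A : PDO B) : PDO B where
  coeff α := ∑ᶠ r : Fin 2 → ℕ, D.coeff (fun ν => (r ν : ℤ)) * dpow r (A.coeff α)
  bdd := by
    obtain ⟨N, hN⟩ := A.bdd
    exact ⟨N, fun α h => hN α fun h0 => h (by simp [h0, dpow_zero_arg])⟩

end Product

end PDO

/-- The unknown functions: `a μ n` stands for `a_{μ,n+1}`, and `β` for `β`. -/
inductive Unknown : Type
  | a (μ : Fin 2) (n : ℕ)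
  | β

/-- Polynomials in the jets `∂₁^(r 0) ∂₂^(r 1) u` of the unknown functions `u`. -/
abbrev JetPoly : Type := MvPolynomial (Unknown × (Fin 2 → ℕ)) ℂ

/-- Differential polynomials in the unknown functions and `e^{±β}`; the variable of the Laurent
polynomials is `e^β`. -/
abbrev JetAlg : Type := LaurentPolynomial JetPoly

/-- The function `e^{n β}`. -/
def expβ (n : ℤ) : JetAlg := LaurentPolynomial.T n

/-- The jet `∂₁^(r 0) ∂₂^(r 1) u`. -/
def jet (u : Unknown) (r : Fin 2 → ℕ) : JetAlg := LaurentPolynomial.C (MvPolynomial.X (u, r))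

/-- The linear map `∑ p_n e^{n β} ↦ ∑ (δ(p_n) + n c p_n) e^{n β}`. -/
def extendLin (δ : Derivation ℂ JetPoly JetAlg) (c : JetAlg) : JetAlg →ₗ[ℂ] JetAlg where
  toFun f := f.coeff.sum fun n p => (δ p + n • (c * LaurentPolynomial.C p)) * expβ n
  map_add' f g := by
    rw [AddMonoidAlgebra.coeff_add, Finsupp.sum_add_index']
    · intro n; simp
    · intro n p q; simp only [map_add, mul_add, smul_add, add_mul]; abel
  map_smul' z f := by
    rw [AddMonoidAlgebra.coeff_smul, Finsupp.sum_smul_index', RingHom.id_apply, Finsupp.smul_sum]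
    · refine Finsupp.sum_congr fun n _ => ?_
      have hC : ∀ p : JetPoly, (LaurentPolynomial.C (z • p) : JetAlg)
          = z • LaurentPolynomial.C p := fun p => by
        rw [LaurentPolynomial.C_eq_algebraMap, LaurentPolynomial.C_eq_algebraMap]
        exact algebraMap.coe_smul ..
      rw [Derivation.map_smul, hC, mul_smul_comm, smul_comm n z, ← smul_add, smul_mul_assoc]
    · intro n; simp

lemma extendLin_C_mul_T (δ : Derivation ℂ JetPoly JetAlg) (c : JetAlg) (p : JetPoly) (n : ℤ) :
    extendLin δ c (LaurentPolynomial.C p * LaurentPolynomial.T n)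
      = (δ p + n • (c * LaurentPolynomial.C p)) * expβ n := by
  rw [← LaurentPolynomial.single_eq_C_mul_T]
  have h : extendLin δ c (AddMonoidAlgebra.single n p)
      = (AddMonoidAlgebra.single n p).coeff.sum
        fun n p => (δ p + n • (c * LaurentPolynomial.C p)) * expβ n := rfl
  rw [h, AddMonoidAlgebra.coeff_single, Finsupp.sum_single_index]
  simp

/-- The derivation of `JetAlg` that extends `δ` and sends `e^β` to `c e^β`. -/
def extend (δ : Derivation ℂ JetPoly JetAlg) (c : JetAlg) : Derivation ℂ JetAlg JetAlg :=
  Derivation.mk' (extendLin δ c) fun f g => by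
    induction f using LaurentPolynomial.induction_on' with
    | add f₁ f₂ h₁ h₂ => simp only [add_mul, map_add, h₁, h₂, smul_eq_mul, mul_add]; ring
    | C_mul_T m p =>
      induction g using LaurentPolynomial.induction_on' with
      | add g₁ g₂ h₁ h₂ => simp only [add_mul, map_add, h₁, h₂, smul_eq_mul, mul_add]; ring
      | C_mul_T n q =>
        have h : (LaurentPolynomial.C p * LaurentPolynomial.T m *
            (LaurentPolynomial.C q * LaurentPolynomial.T n) : JetAlg)
            = LaurentPolynomial.C (p * q) * LaurentPolynomial.T (m + n) := by
          rw [map_mul, LaurentPolynomial.T_add]; ring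
        rw [h, extendLin_C_mul_T, extendLin_C_mul_T, extendLin_C_mul_T, Derivation.leibniz]
        simp only [expβ, LaurentPolynomial.T_add, map_mul, smul_eq_mul, add_smul,
          Algebra.smul_def p, Algebra.smul_def q, ← LaurentPolynomial.C_eq_algebraMap]
        simp only [zsmul_eq_mul]
        ring

lemma extend_C_mul_T (δ : Derivation ℂ JetPoly JetAlg) (c : JetAlg) (p : JetPoly) (n : ℤ) :
    extend δ c (LaurentPolynomial.C p * LaurentPolynomial.T n)
      = (δ p + n • (c * LaurentPolynomial.C p)) * expβ n :=
  extendLin_C_mul_T δ c p n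

/-- The derivation `∂_ν`: it raises the `ν`-th order of each jet by one, and
`∂_ν(e^β) = ∂_ν(β) e^β`. -/
def jetD (ν : Fin 2) : Derivation ℂ JetAlg JetAlg :=
  extend (MvPolynomial.mkDerivation ℂ fun x => jet x.1 (x.2 + Pi.single ν 1))
    (jet Unknown.β (Pi.single ν 1))

lemma jetD_jet (ν : Fin 2) (u : Unknown) (r : Fin 2 → ℕ) :
    jetD ν (jet u r) = jet u (r + Pi.single ν 1) := by
  have h := extend_C_mul_T (MvPolynomial.mkDerivation ℂ fun x => jet x.1 (x.2 + Pi.single ν 1))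
    (jet Unknown.β (Pi.single ν 1)) (MvPolynomial.X (u, r)) 0
  rw [LaurentPolynomial.T_zero, mul_one, MvPolynomial.mkDerivation_X, zero_smul, add_zero] at h
  exact h.trans (mul_one _)

lemma jetD_expβ (ν : Fin 2) (n : ℤ) :
    jetD ν (expβ n) = n • (jet Unknown.β (Pi.single ν 1) * expβ n) := by
  have h := extend_C_mul_T (MvPolynomial.mkDerivation ℂ fun x => jet x.1 (x.2 + Pi.single ν 1))
    (jet Unknown.β (Pi.single ν 1)) 1 n
  rw [map_one, one_mul, Derivation.map_one_eq_zero, zero_add, mul_one, smul_mul_assoc] at h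
  exact h

lemma derivation_eq_zero (D : Derivation ℂ JetAlg JetAlg) (hj : ∀ u r, D (jet u r) = 0)
    (he : ∀ n, D (expβ n) = 0) : D = 0 := by
  have hC : ∀ p : JetPoly, D (LaurentPolynomial.C p) = 0 := fun p => by
    induction p using MvPolynomial.induction_on with
    | C z =>
      have : (LaurentPolynomial.C (MvPolynomial.C z) : JetAlg) = algebraMap ℂ JetAlg z := rfl
      rw [this, Derivation.map_algebraMap]
    | add p q hp hq => rw [map_add, map_add, hp, hq, add_zero]
    | mul_X p x hp =>
      have hx : D (LaurentPolynomial.C (MvPolynomial.X x)) = 0 := hj x.1 x.2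
      rw [map_mul, Derivation.leibniz, hp, hx, smul_zero, smul_zero, add_zero]
  refine Derivation.ext fun f => ?_
  induction f using LaurentPolynomial.induction_on' with
  | add f g hf hg => rw [map_add, map_add, hf, hg]
  | C_mul_T n p =>
    have hT : D (LaurentPolynomial.T n) = 0 := he n
    rw [Derivation.leibniz, hC, hT, smul_zero, smul_zero, add_zero, Derivation.zero_apply]

lemma jetD_comm (f : JetAlg) : jetD 0 (jetD 1 f) = jetD 1 (jetD 0 f) := by
  have h : ⁅jetD 0, jetD 1⁆ = 0 := by
    refine derivation_eq_zero _ (fun u r => ?_) fun n => ?_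
    · rw [Derivation.commutator_apply, jetD_jet, jetD_jet, jetD_jet, jetD_jet, add_right_comm,
        sub_self]
    · rw [Derivation.commutator_apply, jetD_expβ, jetD_expβ, map_zsmul, map_zsmul,
        Derivation.leibniz, Derivation.leibniz, jetD_jet, jetD_jet, jetD_expβ, jetD_expβ,
        add_comm (Pi.single 0 1 : Fin 2 → ℕ)]
      simp only [smul_eq_mul, zsmul_eq_mul]
      ring
  have h' := congrArg (fun D : Derivation ℂ JetAlg JetAlg => D f) h
  simp only [Derivation.commutator_apply, Derivation.zero_apply] at h'
  exact sub_eq_zero.mp h'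

instance : BiDifferential JetAlg where
  d := jetD
  d_comm := jetD_comm

/-- The unknown function `β`. -/
def betaFn : JetAlg := jet Unknown.β 0

/-- The sequence `1, a_{μ,1}, a_{μ,2}, …`. -/
def aSeq (μ : Fin 2) : ℕ → JetAlg
  | 0 => 1
  | n + 1 => jet (Unknown.a μ n) 0

/-- The dressing operators `Φ₁ = 1 + ∑_{i ≥ 1} a_{1,i} ∂₁^{-i}` and
`Φ₂ = e^β (1 + ∑_{i ≥ 1} a_{2,i} ∂₂^{-i})`. -/
def Phi : Fin 2 → PDO JetAlg
  | 0 => PDO.series 0 (aSeq 0)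
  | 1 => PDO.fn (expβ 1) * PDO.series 1 (aSeq 1)

/-- `P_ν = Φ_ν ∂_ν Φ_ν⁻¹`. -/
def P (ν : Fin 2) : PDO JetAlg := Phi ν * PDO.del ν * (Phi ν)⁻¹

/-- `(P_1^k)_{<0}` and `(P_2^k)_{<1}`. -/
def Pneg (ν : Fin 2) (k : ℕ) : PDO JetAlg := PDO.truncLT ν ((ν : ℕ) : ℤ) (P ν ^ k)

/-- `(P_1^k)_{≥0}` and `(P_2^k)_{≥1}`. -/
def Ppos (ν : Fin 2) (k : ℕ) : PDO JetAlg := PDO.truncGE ν ((ν : ℕ) : ℤ) (P ν ^ k)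

/-- The right-hand side of the evolutionary equation for `∂Φ_μ/∂t_{ν,k}`. -/
def flowRHS (ν : Fin 2) (k : ℕ) (μ : Fin 2) : PDO JetAlg :=
  if μ = ν then -Pneg ν k * Phi μ else (Ppos ν k).act (Phi μ)

/-- `T` is the flow `∂/∂t_{ν,k}`: a derivation that commutes with `∂₁` and `∂₂`, respects the
relation between `β` and `e^β`, and satisfies the evolutionary equations for `Φ₁` and `Φ₂`. -/
structure IsFlow (ν : Fin 2) (k : ℕ) (T : Derivation ℂ JetAlg JetAlg) : Prop where
  comm : ∀ κ f, T (jetD κ f) = jetD κ (T f)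
  exp : T (expβ 1) = expβ 1 * T betaFn
  evol : ∀ μ, PDO.mapCoeff T (Phi μ) = flowRHS ν k μ

/-- `B_{ν,k}^μ`, so that the evolutionary equations read `∂Φ_μ/∂t_{ν,k} = B_{ν,k}^μ Φ_μ`. -/
def Bop (ν : Fin 2) (k : ℕ) (μ : Fin 2) : PDO JetAlg :=
  if μ = ν then -Pneg ν k else (Ppos ν k).act (Phi μ) * (Phi μ)⁻¹

/-- The left-hand side `e^β ∂₁ e^{-β} Φ₁ ∂₂ Φ₁⁻¹` of the constraint. -/
def H₁ : PDO JetAlg :=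
  PDO.fn (expβ 1) * PDO.del 0 * PDO.fn (expβ (-1)) * Phi 0 * PDO.del 1 * (Phi 0)⁻¹

/-- The right-hand side `∂₂ Φ₂ ∂₁ Φ₂⁻¹` of the constraint. -/
def H₂ : PDO JetAlg := PDO.del 1 * Phi 1 * PDO.del 0 * (Phi 1)⁻¹

/-- The differential ideal generated by the constraint `H₁ = H₂`, that is, by the coefficients of
`H₁ - H₂` and all their derivatives. -/
def constraintIdeal : Ideal JetAlg :=
  Ideal.span {f | ∃ (r : Fin 2 → ℕ) (α : Fin 2 → ℤ), f = dpow r ((H₁ - H₂).coeff α)}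

end KPmKP

end

open KPmKP

/-!
# Compatibility of the KP-mKP hierarchy

Each `B_{ν,k}^μ` differs from the differential operator `D_{ν,k} = Ppos ν k` by a tractable term:
for `μ = ν` by the power `P_ν^k`, which commutes with `Φ_ν ∂_κ Φ_ν⁻¹`, and for `μ ≠ ν` by a left
multiple of `Φ_μ ∂_ν Φ_μ⁻¹` (`Dressing.exists_Bop_eq`). The latter holds because `D⟨Φ⟩` is the part
of order zero in `∂_ν` of the product `D Φ` (`PDO.exists_mul_eq_act_add`). Hence every expression in
the `B_{ν,k}^μ` can be computed with the `D_{ν,k}` modulo left multiples of the two operators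
`Φ₁ ∂₂ Φ₁⁻¹` and `Φ₂ ∂₁ Φ₂⁻¹`. These are, up to invertible left factors, the two sides `H₁` and `H₂`
of the constraint.

Everything then follows by comparing orders. An operator with nonnegative powers of `∂_ν` only
vanishes if its order in `∂_ν` is negative, and `H₁` and `H₂` are invertible with inverses of order
`-1` in `∂₂` and in `∂₁` respectively.

* The constraint: a flow acts by `H_i ↦ M_i H_i - H_i D` with `M_i` free of negative powers of
  `∂_ν`. Modulo the constraint, `H₁ - H₂` is therefore mapped to `(M₁ - M₂) H`; as its order in
  `∂_ν` is at most zero, `M₁ - M₂` vanishes (`Dressing.IsFlow.mapCoeff_constraint`).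
* Zero curvature for two flows of one series needs no constraint: on `Φ_ν` it is the classical
  splitting argument (`Dressing.IsFlow.curvature_self`), and the other curvature is a left multiple
  of `Φ_μ ∂_ν Φ_μ⁻¹` free of `∂_ν` (`Dressing.IsFlow.curvature_of_ne`).
* For one flow of each series, the difference of the curvatures on `Φ₁` and `Φ₂` is a left multiple
  of `H` under the constraint, and vanishes by its orders in `∂₁` and `∂₂`
  (`Dressing.IsFlow.curvature_mixed`).

The commutator of two flows maps `Φ_μ` to the curvature times `Φ_μ`, and a derivation of the algebra
of differential polynomials is determined, also modulo a differential ideal, by its values on `Φ₁`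
and `Φ₂` (`derivation_mem_of_Phi`). The latter also gives the uniqueness of the flows.

The computations take place in the ring of pseudo-differential operators. For its associativity the
product is written as `A C = ∑ A_α (∂^α C)` (`PDO.coeff_mul`) and the claim is reduced to left
multiplication by `∂₁` and `∂₂` (`PDO.delPow_mul`). The hierarchy is treated over an arbitrary
coefficient algebra with two commuting derivations, without reference to jets. "Modulo the
constraint" means that all coefficients lie in the ideal (`PDO.coeffsIn`); no quotient algebra is
formed.
-/

noncomputable section

namespace KPmKP

open BiDifferential Function

/-! ### Iterated derivatives -/

section Derivatives

variable {B : Type*} [CommRing B] [Algebra ℂ B] [BiDifferential B]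

lemma d_comm_apply (μ ν : Fin 2) (f : B) : d μ (d ν f) = d ν (d μ f) := by
  fin_cases μ <;> fin_cases ν
  · rfl
  · exact d_comm f
  · exact (d_comm f).symm
  · rfl

@[simp] lemma dpow_zero (f : B) : dpow 0 f = f := rfl

lemma dpow_add_arg (r : Fin 2 → ℕ) (f g : B) : dpow r (f + g) = dpow r f + dpow r g := by
  simp only [dpow, iterate_map_add]

/-- A derivation commuting with `∂₁` and `∂₂` commutes with all iterated derivatives. -/
lemma map_dpow {T : Derivation ℂ B B} (hT : ∀ κ f, T (d κ f) = d κ (T f)) (r : Fin 2 → ℕ)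
    (f : B) : T (dpow r f) = dpow r (T f) := by
  simp only [dpow]
  have h0 : Semiconj T (d (B := B) 0) (d 0) := hT 0
  have h1 : Semiconj T (d (B := B) 1) (d 1) := hT 1
  rw [(h0.iterate_right _).eq, (h1.iterate_right _).eq]

lemma d_dpow (ν : Fin 2) (r : Fin 2 → ℕ) (f : B) :
    d ν (dpow r f) = dpow (r + Pi.single ν 1) f := by
  fin_cases ν
  · simp [dpow, iterate_succ_apply']
  · simp only [Fin.mk_one]
    rw [map_dpow (d_comm_apply 1)]
    simp [dpow]

lemma dpow_one (r : Fin 2 → ℕ) (hr : r ≠ 0) : dpow r (1 : B) = 0 := by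
  by_cases h1 : r 1 = 0
  · have h0 : r 0 ≠ 0 := fun h0 => hr (by ext i; fin_cases i <;> simp [h0, h1])
    obtain ⟨n, hn⟩ := Nat.exists_eq_succ_of_ne_zero h0
    simp [dpow, h1, hn, iterate_succ_apply, iterate_map_zero]
  · obtain ⟨n, hn⟩ := Nat.exists_eq_succ_of_ne_zero h1
    simp [dpow, hn, iterate_succ_apply, iterate_map_zero]

end Derivatives

namespace PDO

/-! ### Coefficients, orders and truncations -/

section Additive

variable {B : Type*} [CommRing B]

instance : Zero (PDO B) := ⟨{ coeff := 0, bdd := ⟨0, fun _ h => absurd rfl h⟩ }⟩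

@[simp] lemma coeff_zero (α : Fin 2 → ℤ) : (0 : PDO B).coeff α = 0 := rfl
@[simp] lemma coeff_add (A C : PDO B) (α : Fin 2 → ℤ) :
    (A + C).coeff α = A.coeff α + C.coeff α := rfl
@[simp] lemma coeff_neg (A : PDO B) (α : Fin 2 → ℤ) : (-A).coeff α = -A.coeff α := rfl
@[simp] lemma coeff_sub (A C : PDO B) (α : Fin 2 → ℤ) :
    (A - C).coeff α = A.coeff α - C.coeff α := (sub_eq_add_neg _ _).symm
lemma coeff_mono (f : B) (α γ : Fin 2 → ℤ) :
    (mono f α).coeff γ = if γ = α then f else 0 := rfl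
lemma coeff_fn (f : B) (γ : Fin 2 → ℤ) : (fn f).coeff γ = if γ = 0 then f else 0 := rfl
lemma coeff_one (γ : Fin 2 → ℤ) : (1 : PDO B).coeff γ = if γ = 0 then 1 else 0 := rfl

instance : AddCommGroup (PDO B) where
  add_assoc A C E := by ext; simp [add_assoc]
  zero_add A := by ext; simp
  add_zero A := by ext; simp
  add_comm A C := by ext; simp [add_comm]
  neg_add_cancel A := by ext; simp
  sub_eq_add_neg A C := rfl
  nsmul := nsmulRec
  zsmul := zsmulRec

/-- Raising an exponent far enough leaves the support of an operator. -/
lemma finite_raisings {C : PDO B} (δ : Fin 2 → ℤ) :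
    {r : Fin 2 → ℕ | C.coeff (fun ν => δ ν + r ν) ≠ 0}.Finite := by
  obtain ⟨M, hM⟩ := C.bdd
  refine (Set.finite_Iic (fun ν => (M ν - δ ν).toNat)).subset fun r hr ν => ?_
  have : δ ν + r ν ≤ M ν := hM _ hr ν
  simp only
  omega

/-- The exponents of `A` that contribute to the coefficient of `∂^γ` in `A * C` lie in a finite
box depending on `C` only through a bound for its exponents. -/
lemma finite_contributions (A C : PDO B) (γ : Fin 2 → ℤ) :
    ∃ s : Finset (Fin 2 → ℤ), ∀ α, A.coeff α ≠ 0 → ∀ r : Fin 2 → ℕ,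
      C.coeff (fun ν => γ ν - α ν + r ν) ≠ 0 → α ∈ s := by
  obtain ⟨N, hN⟩ := A.bdd
  obtain ⟨M, hM⟩ := C.bdd
  refine ⟨Finset.Icc (γ - M) N, fun α hα r hr => Finset.mem_Icc.2 ⟨fun ν => ?_, hN α hα⟩⟩
  have := hM _ hr ν
  simp only [Pi.sub_apply] at *
  omega

lemma IsSingle.neg {ν : Fin 2} {A : PDO B} (hA : A.IsSingle ν) : (-A).IsSingle ν :=
  fun α hα => hA α (by simpa using hα)

lemma isSingle_zero (ν : Fin 2) : (0 : PDO B).IsSingle ν := fun _ h => absurd rfl h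

lemma isSingle_mono {ν : Fin 2} (f : B) {δ : Fin 2 → ℤ} (h : ∀ κ, κ ≠ ν → δ κ = 0) :
    (mono f δ).IsSingle ν := fun α hα κ hκ => by
  rw [coeff_mono] at hα
  by_cases h' : α = δ
  · rw [h', h κ hκ]
  · simp [h'] at hα

lemma coeff_truncGE (ν : Fin 2) (m : ℤ) (A : PDO B) (α : Fin 2 → ℤ) :
    (truncGE ν m A).coeff α = if m ≤ α ν then A.coeff α else 0 := rfl

lemma coeff_truncLT (ν : Fin 2) (m : ℤ) (A : PDO B) (α : Fin 2 → ℤ) :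
    (truncLT ν m A).coeff α = if α ν < m then A.coeff α else 0 := rfl

/-- The operators of order at most `n` with respect to `∂_ν`. -/
def ordLE (ν : Fin 2) (n : ℤ) : AddSubgroup (PDO B) where
  carrier := {A | ∀ α, A.coeff α ≠ 0 → α ν ≤ n}
  zero_mem' _ h := absurd rfl h
  add_mem' {A C} hA hC α h := by
    by_cases h0 : A.coeff α = 0
    · exact hC α (by simpa [h0] using h)
    · exact hA α h0
  neg_mem' {A} hA α h := hA α (by simpa using h)

/-- The operators whose powers of `∂_ν` all have exponent at least `n`. -/
def ordGE (ν : Fin 2) (n : ℤ) : AddSubgroup (PDO B) where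
  carrier := {A | ∀ α, A.coeff α ≠ 0 → n ≤ α ν}
  zero_mem' _ h := absurd rfl h
  add_mem' {A C} hA hC α h := by
    by_cases h0 : A.coeff α = 0
    · exact hC α (by simpa [h0] using h)
    · exact hA α h0
  neg_mem' {A} hA α h := hA α (by simpa using h)

lemma ordLE_mono {ν : Fin 2} {m n : ℤ} (h : m ≤ n) {A : PDO B} (hA : A ∈ ordLE ν m) :
    A ∈ ordLE ν n := fun α hα => (hA α hα).trans h

lemma ordGE_anti {ν : Fin 2} {m n : ℤ} (h : m ≤ n) {A : PDO B} (hA : A ∈ ordGE ν n) :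
    A ∈ ordGE ν m := fun α hα => h.trans (hA α hα)

lemma coeff_eq_zero_of_ordLE {ν : Fin 2} {n : ℤ} {A : PDO B} (hA : A ∈ ordLE ν n)
    {α : Fin 2 → ℤ} (h : n < α ν) : A.coeff α = 0 :=
  by_contra fun h0 => h.not_ge (hA α h0)

lemma coeff_eq_zero_of_ordGE {ν : Fin 2} {n : ℤ} {A : PDO B} (hA : A ∈ ordGE ν n)
    {α : Fin 2 → ℤ} (h : α ν < n) : A.coeff α = 0 :=
  by_contra fun h0 => h.not_ge (hA α h0)

lemma eq_zero_of_ordLE_of_ordGE {ν : Fin 2} {m n : ℤ} (h : m < n) {A : PDO B}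
    (h1 : A ∈ ordLE ν m) (h2 : A ∈ ordGE ν n) : A = 0 := by
  ext α
  by_contra h0
  exact h.not_ge ((h2 α h0).trans (h1 α h0))

lemma one_mem_ordLE (ν : Fin 2) : (1 : PDO B) ∈ ordLE ν 0 := fun α h => by
  rw [coeff_one] at h
  by_cases hα : α = 0
  · simp [hα]
  · simp [hα] at h

lemma mono_mem_ordLE (f : B) (δ : Fin 2 → ℤ) (ν : Fin 2) : mono f δ ∈ ordLE ν (δ ν) :=
  fun α h => by
    rw [coeff_mono] at h
    by_cases hα : α = δ
    · simp [hα]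
    · simp [hα] at h

lemma mono_mem_ordGE (f : B) (δ : Fin 2 → ℤ) (ν : Fin 2) : mono f δ ∈ ordGE ν (δ ν) :=
  fun α h => by
    rw [coeff_mono] at h
    by_cases hα : α = δ
    · simp [hα]
    · simp [hα] at h

lemma isSingle_iff {κ ν : Fin 2} (h : κ ≠ ν) {A : PDO B} :
    A.IsSingle ν ↔ A ∈ ordLE κ 0 ∧ A ∈ ordGE κ 0 := by
  refine ⟨fun hA => ⟨fun α hα => (hA α hα κ h).le, fun α hα => (hA α hα κ h).ge⟩,
    fun hA α hα κ' h' => ?_⟩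
  obtain rfl : κ' = κ := by omega
  exact le_antisymm (hA.1 α hα) (hA.2 α hα)

lemma IsSingle.ordLE {κ ν : Fin 2} {A : PDO B} (hA : A.IsSingle ν) (h : κ ≠ ν) :
    A ∈ ordLE κ 0 := ((isSingle_iff h).1 hA).1

lemma IsSingle.ordGE {κ ν : Fin 2} {A : PDO B} (hA : A.IsSingle ν) (h : κ ≠ ν) :
    A ∈ ordGE κ 0 := ((isSingle_iff h).1 hA).2

lemma exists_ne_fin_two (ν : Fin 2) : ∃ κ, κ ≠ ν := ⟨ν + 1, by omega⟩

lemma IsSingle.add {ν : Fin 2} {A C : PDO B} (hA : A.IsSingle ν) (hC : C.IsSingle ν) :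
    (A + C).IsSingle ν := by
  obtain ⟨κ, h⟩ := exists_ne_fin_two ν
  exact (isSingle_iff h).2 ⟨add_mem (hA.ordLE h) (hC.ordLE h), add_mem (hA.ordGE h) (hC.ordGE h)⟩

lemma isSingle_fn (f : B) (ν : Fin 2) : (fn f).IsSingle ν := isSingle_mono f fun _ _ => rfl

lemma isSingle_one (ν : Fin 2) : (1 : PDO B).IsSingle ν := isSingle_fn 1 ν

lemma isSingle_del (ν : Fin 2) : (del ν : PDO B).IsSingle ν :=
  isSingle_mono 1 fun _ h => by simp [h]

lemma fn_mem_ordLE (f : B) (ν : Fin 2) : fn f ∈ ordLE ν 0 := mono_mem_ordLE f 0 ν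

lemma fn_mem_ordGE (f : B) (ν : Fin 2) : fn f ∈ ordGE ν 0 := mono_mem_ordGE f 0 ν

/-- The operator `∂_ν⁻¹`. -/
def delInv (ν : Fin 2) : PDO B := mono 1 (Pi.single ν (-1))

lemma isSingle_delInv (ν : Fin 2) : (delInv ν : PDO B).IsSingle ν :=
  isSingle_mono 1 fun _ h => by simp [h]

lemma delInv_mem_ordLE (ν : Fin 2) : (delInv ν : PDO B) ∈ ordLE ν (-1) := by
  have h := mono_mem_ordLE (1 : B) (Pi.single ν (-1)) ν
  rwa [Pi.single_eq_same] at h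

lemma del_mem_ordLE (ν : Fin 2) : (del ν : PDO B) ∈ ordLE ν 1 := by
  have h := mono_mem_ordLE (1 : B) (Pi.single ν 1) ν
  rwa [Pi.single_eq_same] at h

lemma del_mem_ordGE (ν κ : Fin 2) : (del ν : PDO B) ∈ ordGE κ 0 :=
  ordGE_anti ((Pi.single_nonneg.2 zero_le_one : (0 : Fin 2 → ℤ) ≤ Pi.single ν 1) κ)
    (mono_mem_ordGE (1 : B) (Pi.single ν 1) κ)

/-- The operators all of whose coefficients lie in the ideal `I`. -/
def coeffsIn (I : Ideal B) : AddSubgroup (PDO B) where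
  carrier := {A | ∀ α, A.coeff α ∈ I}
  zero_mem' _ := I.zero_mem
  add_mem' hA hC α := I.add_mem (hA α) (hC α)
  neg_mem' hA α := I.neg_mem (hA α)

lemma truncGE_add_truncLT (ν : Fin 2) (m : ℤ) (A : PDO B) :
    truncGE ν m A + truncLT ν m A = A := by
  ext α
  rw [coeff_add, coeff_truncGE, coeff_truncLT]
  by_cases h : m ≤ α ν
  · rw [if_pos h, if_neg h.not_gt, add_zero]
  · rw [if_neg h, if_pos (not_le.1 h), zero_add]

lemma truncGE_mem_ordGE (ν : Fin 2) (m : ℤ) (A : PDO B) : truncGE ν m A ∈ ordGE ν m :=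
  fun _ hα => by_contra fun h => hα (if_neg h)

lemma truncLT_mem_ordLE (ν : Fin 2) (m : ℤ) (A : PDO B) : truncLT ν m A ∈ ordLE ν (m - 1) :=
  fun α hα => by
    by_contra h
    exact hα (if_neg (by omega))

lemma IsSingle.truncGE {ν : Fin 2} {A : PDO B} (hA : A.IsSingle ν) (κ : Fin 2) (m : ℤ) :
    (truncGE κ m A).IsSingle ν :=
  fun α hα => hA α fun h0 => hα (by rw [coeff_truncGE, h0, ite_self])

lemma IsSingle.truncLT {ν : Fin 2} {A : PDO B} (hA : A.IsSingle ν) (κ : Fin 2) (m : ℤ) :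
    (truncLT κ m A).IsSingle ν :=
  fun α hα => hA α fun h0 => hα (by rw [coeff_truncLT, h0, ite_self])

lemma eq_zero_of_forall_mem_ordLE {ν : Fin 2} {A : PDO B} (h : ∀ n : ℕ, A ∈ ordLE ν (-n)) :
    A = 0 := by
  ext α
  by_contra h0
  have := h ((-α ν).toNat + 1) α h0
  push_cast at this
  omega

/-- An operator in `∂_ν` alone of order at most `n` is determined by its coefficients at the
powers `∂_ν^(n - i)`. -/
lemma eq_of_isSingle_of_ordLE {ν : Fin 2} {n : ℤ} {A C : PDO B} (hA : A.IsSingle ν)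
    (hC : C.IsSingle ν) (hA' : A ∈ ordLE ν n) (hC' : C ∈ ordLE ν n)
    (h : ∀ i : ℕ, A.coeff (Pi.single ν (n - i)) = C.coeff (Pi.single ν (n - i))) : A = C := by
  ext α
  by_cases h1 : ∀ κ, κ ≠ ν → α κ = 0
  · by_cases h2 : α ν ≤ n
    · have : α = Pi.single ν (n - ((n - α ν).toNat : ℕ)) := by
        ext κ
        by_cases hκ : κ = ν
        · subst hκ; simp only [Pi.single_eq_same]; omega
        · simp [hκ, h1 κ hκ]
      rw [this, h]
    · rw [coeff_eq_zero_of_ordLE hA' (not_le.1 h2), coeff_eq_zero_of_ordLE hC' (not_le.1 h2)]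
  · rw [by_contra fun h' => h1 (hA α h'), by_contra fun h' => h1 (hC α h')]

section Derivation

variable [Algebra ℂ B]

lemma mapCoeff_add (T : Derivation ℂ B B) (A C : PDO B) :
    mapCoeff T (A + C) = mapCoeff T A + mapCoeff T C := by
  ext α; exact map_add T _ _

lemma coeff_mapCoeff (T : Derivation ℂ B B) (A : PDO B) (α : Fin 2 → ℤ) :
    (mapCoeff T A).coeff α = T (A.coeff α) := rfl

lemma mapCoeff_neg (T : Derivation ℂ B B) (A : PDO B) : mapCoeff T (-A) = -mapCoeff T A := by
  ext α; exact map_neg T _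

lemma mapCoeff_sub (T : Derivation ℂ B B) (A C : PDO B) :
    mapCoeff T (A - C) = mapCoeff T A - mapCoeff T C := by
  rw [sub_eq_add_neg, mapCoeff_add, mapCoeff_neg, sub_eq_add_neg]

lemma mapCoeff_fn (T : Derivation ℂ B B) (f : B) : mapCoeff T (fn f) = fn (T f) := by
  ext α
  rw [coeff_mapCoeff, coeff_fn, coeff_fn]
  split_ifs <;> simp

lemma mapCoeff_mono_one (T : Derivation ℂ B B) (δ : Fin 2 → ℤ) : mapCoeff T (mono 1 δ) = 0 := by
  ext α
  rw [coeff_mapCoeff, coeff_mono]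
  split_ifs <;> simp

lemma mapCoeff_del (T : Derivation ℂ B B) (ν : Fin 2) : mapCoeff T (del ν : PDO B) = 0 :=
  mapCoeff_mono_one T _

lemma coeff_mapCoeff_ne_zero {T : Derivation ℂ B B} {A : PDO B} {α : Fin 2 → ℤ}
    (h : (mapCoeff T A).coeff α ≠ 0) : A.coeff α ≠ 0 :=
  fun h0 => h (by rw [coeff_mapCoeff, h0, map_zero])

lemma mapCoeff_mem_ordLE (T : Derivation ℂ B B) {ν : Fin 2} {n : ℤ} {A : PDO B}
    (hA : A ∈ ordLE ν n) : mapCoeff T A ∈ ordLE ν n :=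
  fun α hα => hA α (coeff_mapCoeff_ne_zero hα)

lemma mapCoeff_mem_ordGE (T : Derivation ℂ B B) {ν : Fin 2} {n : ℤ} {A : PDO B}
    (hA : A ∈ ordGE ν n) : mapCoeff T A ∈ ordGE ν n :=
  fun α hα => hA α (coeff_mapCoeff_ne_zero hα)

end Derivation

end Additive

/-! ### The product of pseudo-differential operators and its associativity -/

section Multiplicative

variable {B : Type*} [CommRing B] [Algebra ℂ B] [BiDifferential B]

/-- The number `binom(α 0, r 0) binom(α 1, r 1)`. -/
def binom (α : Fin 2 → ℤ) (r : Fin 2 → ℕ) : ℤ :=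
  Ring.choose (α 0) (r 0) * Ring.choose (α 1) (r 1)

/-- The product `∂₁^(α 0) ∂₂^(α 1) C`, where `α` may have negative entries. -/
def delPow (α : Fin 2 → ℤ) (C : PDO B) : PDO B where
  coeff γ := ∑ᶠ r : Fin 2 → ℕ, binom α r • dpow r (C.coeff fun ν => γ ν - α ν + r ν)
  bdd := by
    obtain ⟨M, hM⟩ := C.bdd
    refine ⟨M + α, fun γ h => ?_⟩
    obtain ⟨r, hr⟩ := not_forall.mp fun h0 => h (finsum_eq_zero_of_forall_eq_zero h0)
    have hC : C.coeff (fun ν => γ ν - α ν + r ν) ≠ 0 := fun h0 =>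
      hr (by simp [h0, dpow_zero_arg])
    intro ν
    have h2 := hM _ hC ν
    simp only [Pi.add_apply] at *
    omega

lemma coeff_delPow (α : Fin 2 → ℤ) (C : PDO B) (γ : Fin 2 → ℤ) :
    (delPow α C).coeff γ
      = ∑ᶠ r : Fin 2 → ℕ, binom α r • dpow r (C.coeff fun ν => γ ν - α ν + r ν) := rfl

lemma hasFiniteSupport_delPow (c : (Fin 2 → ℕ) → ℤ) (C : PDO B) (δ : Fin 2 → ℤ) :
    HasFiniteSupport fun r : Fin 2 → ℕ => c r • dpow r (C.coeff fun ν => δ ν + r ν) := by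
  refine (finite_raisings (C := C) δ).subset fun r hr h0 => hr ?_
  simp only [h0, dpow_zero_arg, smul_zero]

lemma delPow_add (α : Fin 2 → ℤ) (C E : PDO B) :
    delPow α (C + E) = delPow α C + delPow α E := by
  ext γ
  simp only [coeff_add, coeff_delPow, dpow_add_arg, smul_add]
  exact finsum_add_distrib (hasFiniteSupport_delPow _ C _) (hasFiniteSupport_delPow _ E _)

lemma exists_of_coeff_delPow_ne_zero {α γ : Fin 2 → ℤ} {C : PDO B}
    (h : (delPow α C).coeff γ ≠ 0) :
    ∃ r : Fin 2 → ℕ, binom α r ≠ 0 ∧ C.coeff (fun ν => γ ν - α ν + r ν) ≠ 0 := by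
  obtain ⟨r, hr⟩ := not_forall.mp fun h0 => h (finsum_eq_zero_of_forall_eq_zero h0)
  exact ⟨r, fun h0 => hr (by simp [h0]), fun h0 => hr (by simp [h0, dpow_zero_arg])⟩

lemma hasFiniteSupport_mul (A C : PDO B) (γ : Fin 2 → ℤ) :
    HasFiniteSupport fun α => A.coeff α * (delPow α C).coeff γ := by
  obtain ⟨s, hs⟩ := finite_contributions A C γ
  refine s.finite_toSet.subset fun α hα => ?_
  obtain ⟨r, -, hr⟩ := exists_of_coeff_delPow_ne_zero (right_ne_zero_of_mul hα)
  exact hs α (left_ne_zero_of_mul hα) r hr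

/-- The product `A C` is the sum of the products `A_α (∂^α C)`. -/
lemma coeff_mul (A C : PDO B) (γ : Fin 2 → ℤ) :
    (A * C).coeff γ = ∑ᶠ α, A.coeff α * (delPow α C).coeff γ := by
  have h : (A * C).coeff γ = ∑ᶠ p : (Fin 2 → ℤ) × (Fin 2 → ℕ),
      binom p.1 p.2 • (A.coeff p.1 * dpow p.2 (C.coeff fun ν => γ ν - p.1 ν + p.2 ν)) := rfl
  rw [h, finsum_curry]
  · refine finsum_congr fun α => ?_
    rw [coeff_delPow, mul_finsum' _ _ (hasFiniteSupport_delPow _ C _)]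
    exact finsum_congr fun r => (mul_smul_comm ..).symm
  · obtain ⟨s, hs⟩ := finite_contributions A C γ
    have hfin : (⋃ α ∈ s, (Prod.mk α) '' {r : Fin 2 → ℕ |
        C.coeff (fun ν => γ ν - α ν + r ν) ≠ 0}).Finite :=
      s.finite_toSet.biUnion fun α _ => (finite_raisings (C := C) fun ν => γ ν - α ν).image _
    refine hfin.subset fun p hp => ?_
    have hA : A.coeff p.1 ≠ 0 := fun h0 => hp (by simp [h0])
    have hC : C.coeff (fun ν => γ ν - p.1 ν + p.2 ν) ≠ 0 := fun h0 =>
      hp (by simp [h0, dpow_zero_arg])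
    exact Set.mem_biUnion (hs _ hA _ hC) ⟨p.2, hC, rfl⟩

protected lemma mul_add' (A C E : PDO B) : A * (C + E) = A * C + A * E := by
  ext γ
  simp only [coeff_mul, coeff_add, delPow_add, mul_add]
  exact finsum_add_distrib (hasFiniteSupport_mul A C γ) (hasFiniteSupport_mul A E γ)

protected lemma add_mul' (A C E : PDO B) : (A + C) * E = A * E + C * E := by
  ext γ
  simp only [coeff_mul, coeff_add, add_mul]
  exact finsum_add_distrib (hasFiniteSupport_mul A E γ) (hasFiniteSupport_mul C E γ)

lemma binom_zero_left (r : Fin 2 → ℕ) : binom 0 r = if r = 0 then 1 else 0 := by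
  simp only [binom, Pi.zero_apply, Ring.choose_zero_ite]
  by_cases h : r = 0
  · simp [h]
  · rw [if_neg h]
    by_cases h0 : r 0 = 0
    · have h1 : r 1 ≠ 0 := fun h1 => h (by ext i; fin_cases i <;> simp [h0, h1])
      simp [h1]
    · simp [h0]

lemma binom_zero_right (α : Fin 2 → ℤ) : binom α 0 = 1 := by simp [binom]

lemma delPow_zero (C : PDO B) : delPow 0 C = C := by
  ext γ
  rw [coeff_delPow, finsum_eq_single _ 0]
  · simp [binom_zero_right]
  · intro r hr; simp [binom_zero_left, hr]

lemma coeff_fn_mul (f : B) (A : PDO B) (γ : Fin 2 → ℤ) : (fn f * A).coeff γ = f * A.coeff γ := by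
  rw [coeff_mul, finsum_eq_single _ 0]
  · rw [delPow_zero, coeff_fn, if_pos rfl]
  · intro α hα; rw [coeff_fn, if_neg hα, zero_mul]

protected lemma one_mul' (A : PDO B) : 1 * A = A := by
  ext γ
  exact (coeff_fn_mul 1 A γ).trans (one_mul _)

/-- Multiplication by a power `∂^δ` from the right shifts the exponents. -/
lemma coeff_mul_mono_one (A : PDO B) (δ γ : Fin 2 → ℤ) :
    (A * mono 1 δ).coeff γ = A.coeff (γ - δ) := by
  have h (α : Fin 2 → ℤ) : (delPow α (mono (1 : B) δ)).coeff γ = if α = γ - δ then 1 else 0 := by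
    rw [coeff_delPow, finsum_eq_single _ 0]
    · simp only [binom_zero_right, one_smul, dpow_zero, coeff_mono]
      congr 1
      refine propext ⟨fun h => ?_, fun h => ?_⟩ <;> ext ν <;> have := congrFun h ν <;>
        simp only [Pi.zero_apply, Pi.sub_apply] at * <;> push_cast at * <;> omega
    · intro r hr
      rw [coeff_mono]
      split_ifs
      · rw [dpow_one r hr, smul_zero]
      · rw [dpow_zero_arg, smul_zero]
  rw [coeff_mul, finsum_eq_single _ (γ - δ)]
  · rw [h, if_pos rfl, mul_one]
  · intro α hα; rw [h, if_neg hα, mul_zero]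

protected lemma mul_one' (A : PDO B) : A * 1 = A := by
  ext γ
  exact (coeff_mul_mono_one A 0 γ).trans (by rw [sub_zero])

/-- The product `∂_ν C`. -/
def delMul (ν : Fin 2) (C : PDO B) : PDO B where
  coeff γ := C.coeff (γ - Pi.single ν 1) + d ν (C.coeff γ)
  bdd := by
    obtain ⟨N, hN⟩ := C.bdd
    refine ⟨N + Pi.single ν 1, fun γ h => ?_⟩
    by_cases h0 : C.coeff (γ - Pi.single ν 1) = 0
    · have hγ : C.coeff γ ≠ 0 := fun h1 => h (by simp [h0, h1])
      refine (hN γ hγ).trans (le_add_of_nonneg_right ?_)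
      exact Pi.single_nonneg.2 zero_le_one
    · exact sub_le_iff_le_add.1 (hN _ h0)

lemma coeff_delMul (ν : Fin 2) (C : PDO B) (γ : Fin 2 → ℤ) :
    (delMul ν C).coeff γ = C.coeff (γ - Pi.single ν 1) + d ν (C.coeff γ) := rfl

/-- Pascal's rule. -/
lemma binom_add_single (ν : Fin 2) (α : Fin 2 → ℤ) (r : Fin 2 → ℕ) :
    binom (α + Pi.single ν 1) r
      = binom α r + if r ν = 0 then 0 else binom α (r - Pi.single ν 1) := by
  have pascal (a : ℤ) (n : ℕ) :
      Ring.choose (a + 1) n = Ring.choose a n + if n = 0 then 0 else Ring.choose a (n - 1) := by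
    cases n with
    | zero => simp
    | succ n => rw [Ring.choose_succ_succ, add_comm]; simp
  fin_cases ν
  · simp only [binom, Fin.zero_eta, Pi.add_apply, Pi.single_eq_same, Pi.sub_apply, ne_eq,
      one_ne_zero, not_false_eq_true, Pi.single_eq_of_ne, add_zero, pascal]
    split_ifs <;> simp [add_mul]
  · simp only [binom, Fin.mk_one, Pi.add_apply, Pi.single_eq_same, Pi.sub_apply, ne_eq,
      zero_ne_one, not_false_eq_true, Pi.single_eq_of_ne, add_zero, pascal]
    split_ifs <;> simp [mul_add]

/-- `∂^(α + e_ν) = ∂_ν ∂^α`; this is Pascal's rule together with the Leibniz rule for `∂_ν`. -/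
lemma delPow_add_single (ν : Fin 2) (α : Fin 2 → ℤ) (C : PDO B) :
    delPow (α + Pi.single ν 1) C = delMul ν (delPow α C) := by
  ext γ
  have hinj : Injective fun r : Fin 2 → ℕ => r + Pi.single ν 1 := add_left_injective _
  -- the terms of `∂_ν` applied to the coefficients, reindexed along `r ↦ r + e_ν`
  have h : d ν ((delPow α C).coeff γ) = ∑ᶠ r : Fin 2 → ℕ,
      (if r ν = 0 then 0 else binom α (r - Pi.single ν 1)) •
        dpow r (C.coeff fun κ => (γ - Pi.single ν 1 : Fin 2 → ℤ) κ - α κ + r κ) := by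
    rw [coeff_delPow, map_finsum (d ν) (hasFiniteSupport_delPow _ C _)]
    symm
    rw [← finsum_mem_univ,
      finsum_mem_inter_support_eq _ _ (Set.range fun r : Fin 2 → ℕ => r + Pi.single ν 1)]
    · rw [finsum_mem_range hinj]
      refine finsum_congr fun r => ?_
      rw [map_zsmul, d_dpow, if_neg (by simp), add_tsub_cancel_right]
      congr 3
      ext κ
      simp only [Pi.add_apply, Pi.sub_apply, Nat.cast_add]
      have : ((Pi.single ν 1 : Fin 2 → ℕ) κ : ℤ) = (Pi.single ν 1 : Fin 2 → ℤ) κ := by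
        by_cases h : κ = ν
        · subst h; simp
        · simp [h]
      rw [this]; ring
    · rw [Set.univ_inter, eq_comm, Set.inter_eq_right]
      intro r hr
      refine ⟨r - Pi.single ν 1, tsub_add_cancel_of_le ?_⟩
      have hν : r ν ≠ 0 := fun h0 => hr (by simp [h0])
      intro κ
      by_cases h : κ = ν
      · subst h; simpa using Nat.one_le_iff_ne_zero.2 hν
      · simp [h]
  rw [coeff_delMul, h, coeff_delPow, coeff_delPow]
  rw [← finsum_add_distrib (hasFiniteSupport_delPow _ C _) (hasFiniteSupport_delPow _ C _)]
  refine finsum_congr fun r => ?_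
  rw [binom_add_single, add_smul]
  have : (fun κ => γ κ - (α + Pi.single ν 1 : Fin 2 → ℤ) κ + (r κ : ℤ))
      = fun κ => (γ - Pi.single ν 1 : Fin 2 → ℤ) κ - α κ + r κ := by
    ext κ; simp only [Pi.add_apply, Pi.sub_apply]; ring
  rw [this]

lemma delMul_mul (ν : Fin 2) (C E : PDO B) : delMul ν C * E = delMul ν (C * E) := by
  ext γ
  rw [coeff_delMul, coeff_mul, coeff_mul, coeff_mul, map_finsum (d ν) (hasFiniteSupport_mul C E γ)]
  have h1 : ∀ α, d ν (C.coeff α * (delPow α E).coeff γ)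
      + C.coeff α * (delPow α E).coeff (γ - Pi.single ν 1)
      = C.coeff α * (delPow (α + Pi.single ν 1) E).coeff γ
        + d ν (C.coeff α) * (delPow α E).coeff γ := fun α => by
    rw [Derivation.leibniz, delPow_add_single, coeff_delMul, smul_eq_mul, smul_eq_mul]
    ring
  have f1 : HasFiniteSupport fun α => d ν (C.coeff α * (delPow α E).coeff γ) :=
    (hasFiniteSupport_mul C E γ).subset fun α hα h0 => hα (by simp only at h0 ⊢; rw [h0, map_zero])
  have f2 : HasFiniteSupport fun α => d ν (C.coeff α) * (delPow α E).coeff γ :=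
    hasFiniteSupport_mul (⟨fun α => d ν (C.coeff α), by
      obtain ⟨N, hN⟩ := C.bdd
      exact ⟨N, fun α h => hN α fun h0 => h (by simp [h0])⟩⟩ : PDO B) E γ
  have f3 : HasFiniteSupport fun α => C.coeff (α - Pi.single ν 1) * (delPow α E).coeff γ :=
    hasFiniteSupport_mul (⟨fun α => C.coeff (α - Pi.single ν 1), by
      obtain ⟨N, hN⟩ := C.bdd
      exact ⟨N + Pi.single ν 1, fun α h => sub_le_iff_le_add.1 (hN _ h)⟩⟩ : PDO B) E γ
  have f4 : HasFiniteSupport fun α => C.coeff α * (delPow (α + Pi.single ν 1) E).coeff γ := by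
    refine (f3.preimage (add_left_injective (Pi.single ν (1 : ℤ))).injOn).subset fun α hα => ?_
    simpa using hα
  simp only [coeff_delMul, add_mul]
  rw [finsum_add_distrib f3 f2, add_comm (∑ᶠ α, C.coeff α * _),
    ← finsum_add_distrib f1 (hasFiniteSupport_mul C E _), finsum_congr h1,
    finsum_add_distrib f4 f2]
  congr 1
  rw [← finsum_comp_equiv (Equiv.addRight (Pi.single ν (1 : ℤ)))]
  simp

/-- `∂_ν C = 0` forces each coefficient of `C` to be the derivative of a coefficient of higher
order, and the orders are bounded. -/
lemma delMul_injective (ν : Fin 2) : Injective (delMul ν : PDO B → PDO B) := by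
  intro C E h
  rw [← sub_eq_zero]
  have h0 : ∀ γ, (C - E).coeff (γ - Pi.single ν 1) = -d ν ((C - E).coeff γ) := fun γ => by
    have := congrArg (fun A => A.coeff γ) h
    simp only [coeff_delMul] at this
    simp only [coeff_sub, map_sub]
    linear_combination this
  obtain ⟨N, hN⟩ := (C - E).bdd
  -- descending induction on the order with respect to `∂_ν`
  have key : ∀ n : ℕ, ∀ γ : Fin 2 → ℤ, N ν - n < γ ν → (C - E).coeff γ = 0 := by
    intro n
    induction n with
    | zero =>
      intro γ hγ
      by_contra hne
      have : γ ν ≤ N ν := hN γ hne ν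
      simp at hγ
      omega
    | succ n ih =>
      intro γ hγ
      have := h0 (γ + Pi.single ν 1)
      rw [add_sub_cancel_right] at this
      rw [this, ih, map_zero, neg_zero]
      push_cast at hγ
      simp
      omega
  ext γ
  exact key (N ν - γ ν + 1).toNat γ (by have := Int.self_le_toNat (N ν - γ ν + 1); omega)

/-- A property invariant under the unit translations of `ℤ²` holds everywhere if it holds at `0`. -/
lemma lattice_induction {p : (Fin 2 → ℤ) → Prop} (h0 : p 0)
    (h : ∀ ν α, p (α + Pi.single ν 1) ↔ p α) (α : Fin 2 → ℤ) : p α := by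
  have key : ∀ ν (n : ℤ) α, p (α + Pi.single ν n) ↔ p α := by
    intro ν n
    induction n with
    | zero => simp
    | succ n ih => intro α; rw [Pi.single_add, ← add_assoc, h, ih]
    | pred n ih =>
      intro α
      rw [← h ν, add_assoc, ← Pi.single_add, sub_add_cancel, ih]
  have : α = 0 + Pi.single 0 (α 0) + Pi.single 1 (α 1) := by
    ext i; fin_cases i <;> simp
  rw [this, key, key]
  exact h0

/-- Associativity when the left factor is a power of the derivations. The case of `∂_ν` is
`delMul_mul`; as `∂_ν` is injective, it also yields negative powers. -/
lemma delPow_mul (α : Fin 2 → ℤ) : ∀ C E : PDO B, delPow α C * E = delPow α (C * E) := by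
  refine lattice_induction (p := fun α => ∀ C E : PDO B, delPow α C * E = delPow α (C * E))
    (fun C E => by simp only [delPow_zero]) (fun ν α => ?_) α
  refine forall₂_congr fun C E => ?_
  rw [delPow_add_single, delPow_add_single, delMul_mul, (delMul_injective ν).eq_iff]

protected lemma mul_assoc' (A C E : PDO B) : A * C * E = A * (C * E) := by
  ext γ
  obtain ⟨N, hN⟩ := A.bdd
  obtain ⟨M, hM⟩ := C.bdd
  obtain ⟨K, hK⟩ := E.bdd
  have hC : ∀ α δ, (delPow α C).coeff δ ≠ 0 → δ ≤ M + α := fun α δ h ν => by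
    obtain ⟨r, -, hr⟩ := exists_of_coeff_delPow_ne_zero h
    have := hM _ hr ν
    simp only [Pi.add_apply] at *
    omega
  have hE : ∀ δ, (delPow δ E).coeff γ ≠ 0 → γ ≤ K + δ := fun δ h ν => by
    obtain ⟨r, -, hr⟩ := exists_of_coeff_delPow_ne_zero h
    have := hK _ hr ν
    simp only [Pi.add_apply] at *
    omega
  set f : (Fin 2 → ℤ) × (Fin 2 → ℤ) → B := fun p =>
    A.coeff p.1 * ((delPow p.1 C).coeff p.2 * (delPow p.2 E).coeff γ) with hf
  have hfin : HasFiniteSupport f := by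
    refine ((Set.finite_Icc (γ - K - M) N).prod (Set.finite_Icc (γ - K) (M + N))).subset
      fun p hp => ?_
    have h1 := hN _ (left_ne_zero_of_mul hp)
    have h2 := hC _ _ (left_ne_zero_of_mul (right_ne_zero_of_mul hp))
    have h3 := hE _ (right_ne_zero_of_mul (right_ne_zero_of_mul hp))
    refine ⟨⟨fun ν => ?_, h1⟩, ⟨fun ν => ?_, fun ν => ?_⟩⟩ <;>
    · have h1 := h1 ν
      have h2 := h2 ν
      have h3 := h3 ν
      simp only [Pi.add_apply, Pi.sub_apply] at *
      omega
  have hl : (A * C * E).coeff γ = ∑ᶠ δ, ∑ᶠ α, f (α, δ) := by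
    rw [coeff_mul]
    refine finsum_congr fun δ => ?_
    rw [coeff_mul, finsum_mul' _ _ (hasFiniteSupport_mul A C δ)]
    simp only [hf, mul_assoc]
  have hr : (A * (C * E)).coeff γ = ∑ᶠ α, ∑ᶠ δ, f (α, δ) := by
    rw [coeff_mul]
    refine finsum_congr fun α => ?_
    rw [← delPow_mul, coeff_mul, mul_finsum' _ _ (hasFiniteSupport_mul _ E γ)]
  have hswap : HasFiniteSupport (f ∘ Prod.swap) := hfin.preimage Prod.swap_injective.injOn
  rw [hl, hr, ← finsum_curry f hfin, ← finsum_comp_equiv (Equiv.prodComm _ _)]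
  exact (finsum_curry _ hswap).symm

end Multiplicative

/-! ### The ring of pseudo-differential operators -/

section Ring

variable {B : Type*} [CommRing B] [Algebra ℂ B] [BiDifferential B]

instance : Ring (PDO B) where
  left_distrib := PDO.mul_add'
  right_distrib := PDO.add_mul'
  zero_mul A := by ext γ; simp [coeff_mul]
  mul_zero A := by
    have h := PDO.mul_add' A 0 0
    rwa [add_zero, left_eq_add] at h
  mul_assoc := PDO.mul_assoc'
  one_mul := PDO.one_mul'
  mul_one := PDO.mul_one'
  zsmul := zsmulRec
  neg_add_cancel := neg_add_cancel
  npow k A := A ^ k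
  npow_zero _ := rfl
  npow_succ _ _ := rfl

lemma exists_of_coeff_mul_ne_zero {A C : PDO B} {γ : Fin 2 → ℤ} (h : (A * C).coeff γ ≠ 0) :
    ∃ (α : Fin 2 → ℤ) (r : Fin 2 → ℕ), A.coeff α ≠ 0 ∧ binom α r ≠ 0 ∧
      C.coeff (fun ν => γ ν - α ν + r ν) ≠ 0 := by
  rw [coeff_mul] at h
  obtain ⟨α, hα⟩ := not_forall.mp fun h0 => h (finsum_eq_zero_of_forall_eq_zero h0)
  obtain ⟨r, h1, h2⟩ := exists_of_coeff_delPow_ne_zero (right_ne_zero_of_mul hα)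
  exact ⟨α, r, left_ne_zero_of_mul hα, h1, h2⟩

lemma le_of_binom_ne_zero {α : Fin 2 → ℤ} {r : Fin 2 → ℕ} (h : binom α r ≠ 0) {ν : Fin 2}
    (hα : 0 ≤ α ν) : (r ν : ℤ) ≤ α ν := by
  have hν : Ring.choose (α ν) (r ν) ≠ 0 := by
    fin_cases ν
    · exact left_ne_zero_of_mul h
    · exact right_ne_zero_of_mul h
  by_contra hlt
  lift α ν to ℕ using hα with a
  refine hν ?_
  rw [Ring.choose_natCast, Nat.choose_eq_zero_of_lt (by exact_mod_cast not_le.1 hlt),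
    Nat.cast_zero]

lemma mul_mem_ordLE {ν : Fin 2} {m n k : ℤ} {A C : PDO B} (hA : A ∈ ordLE ν m)
    (hC : C ∈ ordLE ν n) (hk : m + n ≤ k) : A * C ∈ ordLE ν k := fun γ h => by
  obtain ⟨α, r, h1, -, h2⟩ := exists_of_coeff_mul_ne_zero h
  have h3 := hA _ h1
  have h4 : γ ν - α ν + r ν ≤ n := hC _ h2
  omega

/-- Left multiplication by an operator with nonnegative powers of `∂_ν` does not lower the smallest
exponent of `∂_ν`, since `binom(i, r) = 0` for `0 ≤ i < r`. -/
lemma mul_mem_ordGE {ν : Fin 2} {n : ℤ} {A C : PDO B} (hA : A ∈ ordGE ν 0)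
    (hC : C ∈ ordGE ν n) : A * C ∈ ordGE ν n := fun γ h => by
  obtain ⟨α, r, h1, h0, h2⟩ := exists_of_coeff_mul_ne_zero h
  have h3 := le_of_binom_ne_zero h0 (hA _ h1)
  have h4 : n ≤ γ ν - α ν + r ν := hC _ h2
  omega

lemma mul_mono_one_mem_ordGE {ν : Fin 2} {n : ℤ} {A : PDO B} (hA : A ∈ ordGE ν n)
    (δ : Fin 2 → ℤ) {k : ℤ} (hk : k ≤ n + δ ν) : A * mono 1 δ ∈ ordGE ν k := fun γ h => by
  rw [coeff_mul_mono_one] at h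
  have : n ≤ γ ν - δ ν := hA _ h
  omega

lemma IsSingle.mul {ν : Fin 2} {A C : PDO B} (hA : A.IsSingle ν) (hC : C.IsSingle ν) :
    (A * C).IsSingle ν := by
  obtain ⟨κ, h⟩ := exists_ne_fin_two ν
  exact (isSingle_iff h).2 ⟨mul_mem_ordLE (hA.ordLE h) (hC.ordLE h) (zero_add 0).le,
    mul_mem_ordGE (hA.ordGE h) (hC.ordGE h)⟩

lemma IsSingle.pow {ν : Fin 2} {A : PDO B} (hA : A.IsSingle ν) (k : ℕ) : (A ^ k).IsSingle ν := by
  induction k with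
  | zero => rw [pow_zero]; exact isSingle_one ν
  | succ k ih => rw [pow_succ]; exact ih.mul hA

lemma fn_mul_fn (f g : B) : fn f * fn g = fn (f * g) := by
  ext γ
  rw [coeff_fn_mul, coeff_fn, coeff_fn]
  split_ifs <;> simp

lemma mono_one_mul_mono_one (δ ε : Fin 2 → ℤ) :
    (mono 1 δ * mono 1 ε : PDO B) = mono 1 (δ + ε) := by
  ext γ
  simp only [coeff_mul_mono_one, coeff_mono, sub_eq_iff_eq_add]

lemma mul_delInv_mem_ordGE {ν : Fin 2} {n : ℤ} {A : PDO B} (hA : A ∈ ordGE ν (n + 1)) :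
    A * delInv ν ∈ ordGE ν n := mul_mono_one_mem_ordGE hA _ (by simp)

@[simp] lemma del_mul_delInv (ν : Fin 2) : (del ν * delInv ν : PDO B) = 1 := by
  rw [del, delInv, mono_one_mul_mono_one, ← Pi.single_add]
  simp; rfl

@[simp] lemma delInv_mul_del (ν : Fin 2) : (delInv ν * del ν : PDO B) = 1 := by
  rw [del, delInv, mono_one_mul_mono_one, ← Pi.single_add]
  simp; rfl

lemma del_mul (ν : Fin 2) (A : PDO B) : del ν * A = delMul ν A := by
  ext γ
  rw [coeff_mul, finsum_eq_single _ (Pi.single ν 1)]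
  · rw [del, coeff_mono, if_pos rfl, one_mul, ← zero_add (Pi.single ν 1 : Fin 2 → ℤ),
      delPow_add_single, delPow_zero]
  · intro α hα; rw [del, coeff_mono, if_neg hα, zero_mul]

omit [BiDifferential B] in
lemma mapCoeff_one (T : Derivation ℂ B B) : mapCoeff T (1 : PDO B) = 0 := mapCoeff_mono_one T 0

lemma del_mul_sub (ν : Fin 2) (A : PDO B) : del ν * A - A * del ν = mapCoeff (d ν) A := by
  ext γ
  rw [coeff_sub, del_mul, coeff_delMul, del, coeff_mul_mono_one, coeff_mapCoeff,
    add_sub_cancel_left]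

/-- A derivation commuting with `∂₁` and `∂₂` is a derivation of the algebra of operators. -/
lemma mapCoeff_mul {T : Derivation ℂ B B} (hT : ∀ κ f, T (d κ f) = d κ (T f)) (A C : PDO B) :
    mapCoeff T (A * C) = mapCoeff T A * C + A * mapCoeff T C := by
  have h (α γ : Fin 2 → ℤ) : T ((delPow α C).coeff γ) = (delPow α (mapCoeff T C)).coeff γ := by
    rw [coeff_delPow, map_finsum T (hasFiniteSupport_delPow _ C _), coeff_delPow]
    refine finsum_congr fun r => ?_
    rw [map_zsmul, map_dpow hT, coeff_mapCoeff]
  ext γ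
  rw [coeff_mapCoeff, coeff_mul, map_finsum T (hasFiniteSupport_mul A C γ), coeff_add,
    coeff_mul, coeff_mul,
    ← finsum_add_distrib (hasFiniteSupport_mul _ C γ) (hasFiniteSupport_mul A _ γ)]
  refine finsum_congr fun α => ?_
  rw [Derivation.leibniz, h, smul_eq_mul, smul_eq_mul, coeff_mapCoeff]
  ring

lemma dpow_mem {I : Ideal B} (hI : ∀ κ, ∀ f ∈ I, d κ f ∈ I) (r : Fin 2 → ℕ) {f : B}
    (hf : f ∈ I) : dpow r f ∈ I := by
  have h (κ : Fin 2) (n : ℕ) : ∀ f ∈ I, (d (B := B) κ)^[n] f ∈ I := by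
    induction n with
    | zero => exact fun f hf => hf
    | succ n ih => exact fun f hf => ih _ (hI κ f hf)
  exact h 0 _ _ (h 1 _ _ hf)

lemma mul_mem_coeffsIn_right {I : Ideal B} {A : PDO B} (hA : A ∈ coeffsIn I) (C : PDO B) :
    A * C ∈ coeffsIn I := fun γ => by
  rw [coeff_mul]
  exact finsum_induction (· ∈ I) I.zero_mem (fun _ _ => I.add_mem)
    fun α => I.mul_mem_right _ (hA α)

lemma mul_mem_coeffsIn_left {I : Ideal B} (hI : ∀ κ, ∀ f ∈ I, d κ f ∈ I) (A : PDO B)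
    {C : PDO B} (hC : C ∈ coeffsIn I) : A * C ∈ coeffsIn I := fun γ => by
  rw [coeff_mul]
  refine finsum_induction (· ∈ I) I.zero_mem (fun _ _ => I.add_mem)
    fun α => I.mul_mem_left _ ?_
  exact finsum_induction (· ∈ I) I.zero_mem (fun _ _ => I.add_mem)
    fun r => zsmul_mem (dpow_mem hI r (hC _)) _

lemma coeff_act (D A : PDO B) (α : Fin 2 → ℤ) : (D.act A).coeff α
    = ∑ᶠ r : Fin 2 → ℕ, D.coeff (fun ν => (r ν : ℤ)) * dpow r (A.coeff α) := rfl

lemma IsSingle.act {κ : Fin 2} (D : PDO B) {A : PDO B} (hA : A.IsSingle κ) :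
    (D.act A).IsSingle κ := fun α hα => hA α fun h0 => hα (by simp [coeff_act, h0, dpow_zero_arg])

/-- For a differential operator `D` in `∂_ν` and an operator `A` free of `∂_ν`, the part of
order zero in `∂_ν` of the product `D A` is `D⟨A⟩`. -/
lemma coeff_mul_eq_coeff_act {κ ν : Fin 2} (h : κ ≠ ν) {D A : PDO B} (hD : D.IsSingle ν)
    (hD0 : D ∈ ordGE ν 0) (hA : A.IsSingle κ) {γ : Fin 2 → ℤ} (hγ : γ ν = 0) :
    (D * A).coeff γ = (D.act A).coeff γ := by
  have hinj : Injective fun r : Fin 2 → ℕ => fun i => (r i : ℤ) :=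
    fun r s hrs => funext fun i => Nat.cast_injective (congrFun hrs i)
  have hsingle : ∀ r : Fin 2 → ℕ, D.coeff (fun i => (r i : ℤ)) ≠ 0 →
      (delPow (fun i => (r i : ℤ)) A).coeff γ = dpow r (A.coeff γ) := by
    intro r hr
    have hκ : r κ = 0 := by exact_mod_cast hD _ hr κ h
    rw [coeff_delPow, finsum_eq_single _ r]
    · have : binom (fun i => (r i : ℤ)) r = 1 := by simp [binom, Ring.choose_natCast]
      rw [this, one_smul]
      simp
    · intro s hs
      by_contra h0
      have h1 : binom (fun i => (r i : ℤ)) s ≠ 0 := fun h1 => h0 (by rw [h1, zero_smul])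
      have h2 : A.coeff (fun i => γ i - r i + s i) ≠ 0 := fun h2 =>
        h0 (by simp only [h2, dpow_zero_arg, smul_zero])
      have h3 : γ ν - r ν + s ν = 0 := hA _ h2 ν h.symm
      have h4 := le_of_binom_ne_zero h1 (ν := κ) (by simp)
      refine hs (funext fun i => ?_)
      have hi : i = κ ∨ i = ν := by omega
      rcases hi with rfl | rfl <;> omega
  rw [coeff_mul, coeff_act, ← finsum_mem_univ,
    finsum_mem_inter_support_eq _ _ (Set.range fun r : Fin 2 → ℕ => fun i => (r i : ℤ)),
    finsum_mem_range hinj]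
  · refine finsum_congr fun r => ?_
    by_cases hr : D.coeff (fun i => (r i : ℤ)) = 0
    · simp only [hr, zero_mul]
    · simp only [hsingle r hr]
  · rw [Set.univ_inter, eq_comm, Set.inter_eq_right]
    intro α hα
    have hDα := left_ne_zero_of_mul hα
    refine ⟨fun i => (α i).toNat, funext fun i => Int.toNat_of_nonneg ?_⟩
    have hi : i = κ ∨ i = ν := by omega
    rcases hi with rfl | rfl
    · exact (hD _ hDα _ h).ge
    · exact hD0 _ hDα

/-- Modulo left multiples of `∂_ν`, the product of a differential operator `D` in `∂_ν` and an
operator `A` free of `∂_ν` is `D⟨A⟩`. -/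
lemma exists_mul_eq_act_add {κ ν : Fin 2} (h : κ ≠ ν) {D A : PDO B} (hD : D.IsSingle ν)
    (hD0 : D ∈ ordGE ν 0) (hA : A.IsSingle κ) :
    ∃ X ∈ ordGE ν 0, D * A = D.act A + X * del ν := by
  refine ⟨(D * A - D.act A) * delInv ν, mul_delInv_mem_ordGE fun γ hγ => ?_, ?_⟩
  · have h0 : (0 : ℤ) ≤ γ ν := by
      refine (sub_mem (mul_mem_ordGE hD0 (hA.ordGE h.symm)) ?_ : D * A - D.act A ∈ ordGE ν 0) γ hγ
      exact (hA.act D).ordGE h.symm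
    by_contra hlt
    exact hγ (by rw [coeff_sub, coeff_mul_eq_coeff_act h hD hD0 hA (by omega), sub_self])
  · rw [mul_assoc, delInv_mul_del, mul_one, add_sub_cancel]

lemma inv_eq_of_mul_eq_one {A C : PDO B} (h1 : A * C = 1) (h2 : C * A = 1) : A⁻¹ = C := by
  have h : A * A⁻¹ = 1 ∧ A⁻¹ * A = 1 :=
    @Classical.epsilon_spec (PDO B) (fun C => A * C = 1 ∧ C * A = 1) ⟨C, h1, h2⟩
  exact left_inv_eq_right_inv h.2 h1

lemma pow_mem_ordLE {ν : Fin 2} {X : PDO B} (hX : X ∈ ordLE ν (-1)) (n : ℕ) :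
    X ^ n ∈ ordLE ν (-n) := by
  induction n with
  | zero => rw [pow_zero]; simpa using one_mem_ordLE ν
  | succ n ih => rw [pow_succ]; exact mul_mem_ordLE ih hX (by push_cast; omega)

/-- An operator `1 - X` in `∂_ν` alone, with `X` of negative order, is inverted by the geometric
series. -/
lemma exists_inverse_one_sub {ν : Fin 2} {X : PDO B} (hX : X ∈ ordLE ν (-1))
    (hs : X.IsSingle ν) : ∃ Y : PDO B, Y.IsSingle ν ∧ Y ∈ ordLE ν 0 ∧
      (1 - X) * Y = 1 ∧ Y * (1 - X) = 1 := by
  set S : ℕ → PDO B := fun n => ∑ i ∈ Finset.range n, X ^ i with hS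
  have hSsucc (n : ℕ) : S (n + 1) = S n + X ^ n := Finset.sum_range_succ _ n
  have hS0 (n : ℕ) : S n ∈ ordLE ν 0 :=
    sum_mem fun i _ => ordLE_mono (by simp) (pow_mem_ordLE hX i)
  have hSs (n : ℕ) : (S n).IsSingle ν := by
    induction n with
    | zero => exact isSingle_zero ν
    | succ n ih => rw [hSsucc]; exact ih.add (hs.pow n)
  have hstable {α : Fin 2 → ℤ} {m n : ℕ} (hm : -(m : ℤ) < α ν) (hmn : m ≤ n) :
      (S n).coeff α = (S m).coeff α := by
    induction n, hmn using Nat.le_induction with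
    | base => rfl
    | succ n hmn ih =>
      rw [hSsucc, coeff_add,
        coeff_eq_zero_of_ordLE (pow_mem_ordLE hX n) (by omega), add_zero, ← ih]
  let Y : PDO B :=
    { coeff := fun α => (S ((-α ν).toNat + 1)).coeff α
      bdd := by
        refine ⟨0, fun α hα κ => ?_⟩
        by_cases hκ : κ = ν
        · subst hκ; exact hS0 _ α hα
        · exact (hSs _ α hα κ hκ).le }
  have hYS (n : ℕ) : Y - S n ∈ ordLE ν (-n) := fun α hα => by
    by_contra hlt
    refine hα ?_
    have hY : Y.coeff α = (S ((-α ν).toNat + 1)).coeff α := rfl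
    have hm : -(((-α ν).toNat + 1 : ℕ) : ℤ) < α ν := by push_cast; omega
    rw [coeff_sub, hY, sub_eq_zero]
    rcases le_total ((-α ν).toNat + 1) n with h | h
    · exact (hstable hm h).symm
    · exact hstable (not_le.1 hlt) h
  have h1X : 1 - X ∈ ordLE ν 0 := sub_mem (one_mem_ordLE ν) (ordLE_mono (by simp) hX)
  refine ⟨Y, fun α hα => hSs _ α hα, fun α hα => hS0 _ α hα, ?_, ?_⟩
  · rw [← sub_eq_zero]
    refine eq_zero_of_forall_mem_ordLE (ν := ν) fun n => ?_
    have : (1 - X) * Y - 1 = (1 - X) * (Y - S n) - X ^ n := by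
      rw [mul_sub, hS, mul_neg_geom_sum]; abel
    rw [this]
    exact sub_mem (mul_mem_ordLE h1X (hYS n) (zero_add _).le) (pow_mem_ordLE hX n)
  · rw [← sub_eq_zero]
    refine eq_zero_of_forall_mem_ordLE (ν := ν) fun n => ?_
    have : Y * (1 - X) - 1 = (Y - S n) * (1 - X) - X ^ n := by
      rw [sub_mul, hS, geom_sum_mul_neg]; abel
    rw [this]
    exact sub_mem (mul_mem_ordLE (hYS n) h1X (add_zero _).le) (pow_mem_ordLE hX n)

end Ring
end PDO

open PDO

/-! ### Dressing operators over an arbitrary coefficient algebra -/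

/-- Coefficients `1, a_{μ,1}, a_{μ,2}, …` of two dressing operators and an invertible function
`e = e^β`, over an arbitrary coefficient algebra. -/
structure Dressing (B : Type*) [CommRing B] where
  e : B
  e' : B
  e_mul_e' : e * e' = 1
  a : Fin 2 → ℕ → B
  a_zero : ∀ μ, a μ 0 = 1

namespace Dressing

section Orders

variable {B : Type*} [CommRing B]

lemma coeff_series_single (ν : Fin 2) (f : ℕ → B) (n : ℕ) :
    (series ν f).coeff (Pi.single ν (-(n : ℤ))) = f n := by
  have h : (Pi.single ν (-(n : ℤ)) : Fin 2 → ℤ) ν ≤ 0 ∧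
      ∀ κ, κ ≠ ν → (Pi.single ν (-(n : ℤ)) : Fin 2 → ℤ) κ = 0 :=
    ⟨by simp, fun κ hκ => by simp [hκ]⟩
  exact (if_pos h).trans (by simp)

lemma isSingle_series (ν : Fin 2) (f : ℕ → B) : (series ν f).IsSingle ν :=
  fun α hα => by
    by_contra h
    exact hα (if_neg fun h' => h h'.2)

lemma series_mem_ordLE (ν : Fin 2) (f : ℕ → B) : series ν f ∈ ordLE ν 0 :=
  fun α hα => by
    by_contra h
    exact hα (if_neg fun h' => h h'.1)

lemma series_sub_one_mem_ordLE (ν : Fin 2) {f : ℕ → B} (hf : f 0 = 1) :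
    series ν f - 1 ∈ ordLE ν (-1) := fun α hα => by
  have hs : (series ν f - 1).IsSingle ν := by
    rw [sub_eq_add_neg]; exact (isSingle_series ν _).add (isSingle_one ν).neg
  have h0 : α ν ≤ 0 := sub_mem (series_mem_ordLE ν f) (one_mem_ordLE ν) α hα
  by_contra hlt
  have : α = 0 := by
    ext κ
    by_cases hκ : κ = ν
    · subst hκ; simp only [Pi.zero_apply]; omega
    · exact hs α hα κ hκ
  have h1 := coeff_series_single ν f 0
  rw [Nat.cast_zero, neg_zero, Pi.single_zero] at h1
  exact hα (by rw [this, coeff_sub, h1, coeff_one, if_pos rfl, hf, sub_self])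

lemma fn_one : fn (1 : B) = 1 := rfl

end Orders

section Generic

variable {B : Type*} [CommRing B] [Algebra ℂ B] [BiDifferential B] (𝒟 : Dressing B)

/-- The dressing operators `Φ₁` and `Φ₂`. -/
def Φ : Fin 2 → PDO B
  | 0 => series 0 (𝒟.a 0)
  | 1 => fn 𝒟.e * series 1 (𝒟.a 1)

lemma Φ_one : 𝒟.Φ 1 = fn 𝒟.e * series 1 (𝒟.a 1) := rfl

lemma fn_e_mul : fn 𝒟.e * fn 𝒟.e' = (1 : PDO B) := by rw [fn_mul_fn, 𝒟.e_mul_e', fn_one]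

lemma fn_e'_mul : fn 𝒟.e' * fn 𝒟.e = (1 : PDO B) := by
  rw [fn_mul_fn, mul_comm, 𝒟.e_mul_e', fn_one]

lemma exists_inverse_Φ (ν : Fin 2) : ∃ Y : PDO B, Y.IsSingle ν ∧ Y ∈ ordLE ν 0 ∧
    𝒟.Φ ν * Y = 1 ∧ Y * 𝒟.Φ ν = 1 := by
  have hs : (1 - series ν (𝒟.a ν)).IsSingle ν := by
    rw [sub_eq_add_neg]; exact (isSingle_one ν).add (isSingle_series ν _).neg
  have hX : 1 - series ν (𝒟.a ν) ∈ ordLE ν (-1) := by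
    rw [← neg_sub]; exact neg_mem (series_sub_one_mem_ordLE ν (𝒟.a_zero ν))
  obtain ⟨Y, h1, h2, h3, h4⟩ := exists_inverse_one_sub hX hs
  rw [sub_sub_cancel] at h3 h4
  have hν : ν = 0 ∨ ν = 1 := by omega
  rcases hν with rfl | rfl
  · exact ⟨Y, h1, h2, h3, h4⟩
  · refine ⟨Y * fn 𝒟.e', h1.mul (isSingle_fn _ 1),
      mul_mem_ordLE h2 (fn_mem_ordLE _ 1) (zero_add 0).le, ?_, ?_⟩
    · rw [Φ_one, mul_assoc, ← mul_assoc _ Y, h3, one_mul, fn_e_mul]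
    · rw [Φ_one, mul_assoc, ← mul_assoc (fn 𝒟.e'), fn_e'_mul, one_mul, h4]

@[simp] lemma Φ_mul_inv (ν : Fin 2) : 𝒟.Φ ν * (𝒟.Φ ν)⁻¹ = 1 := by
  obtain ⟨Y, -, -, h1, h2⟩ := 𝒟.exists_inverse_Φ ν
  rw [inv_eq_of_mul_eq_one h1 h2, h1]

@[simp] lemma inv_mul_Φ (ν : Fin 2) : (𝒟.Φ ν)⁻¹ * 𝒟.Φ ν = 1 := by
  obtain ⟨Y, -, -, h1, h2⟩ := 𝒟.exists_inverse_Φ ν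
  rw [inv_eq_of_mul_eq_one h1 h2, h2]

lemma isSingle_inv_Φ (ν : Fin 2) : ((𝒟.Φ ν)⁻¹).IsSingle ν := by
  obtain ⟨Y, h, -, h1, h2⟩ := 𝒟.exists_inverse_Φ ν
  rwa [inv_eq_of_mul_eq_one h1 h2]

lemma inv_Φ_mem_ordLE (ν : Fin 2) : (𝒟.Φ ν)⁻¹ ∈ ordLE ν 0 := by
  obtain ⟨Y, -, h, h1, h2⟩ := 𝒟.exists_inverse_Φ ν
  rwa [inv_eq_of_mul_eq_one h1 h2]

lemma isSingle_Φ (ν : Fin 2) : (𝒟.Φ ν).IsSingle ν := by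
  have hν : ν = 0 ∨ ν = 1 := by omega
  rcases hν with rfl | rfl
  · exact isSingle_series 0 _
  · exact (isSingle_fn _ 1).mul (isSingle_series 1 _)

lemma Φ_mem_ordLE (ν : Fin 2) : 𝒟.Φ ν ∈ ordLE ν 0 := by
  have hν : ν = 0 ∨ ν = 1 := by omega
  rcases hν with rfl | rfl
  · exact series_mem_ordLE 0 _
  · exact mul_mem_ordLE (fn_mem_ordLE _ 1) (series_mem_ordLE 1 _) (zero_add 0).le

lemma Φ_one_sub_mem_ordLE : 𝒟.Φ 1 - fn 𝒟.e ∈ ordLE 1 (-1) := by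
  have : 𝒟.Φ 1 - fn 𝒟.e = fn 𝒟.e * (series 1 (𝒟.a 1) - 1) := by rw [Φ_one, mul_sub, mul_one]
  rw [this]
  exact mul_mem_ordLE (fn_mem_ordLE _ 1) (series_sub_one_mem_ordLE 1 (𝒟.a_zero 1)) (zero_add _).le

/-- The dressed derivation `Φ_μ ∂_κ Φ_μ⁻¹`. For `κ = μ` this is `P_μ`; for `κ ≠ μ` it is one of the
two factors of the sides of the constraint. -/
def dressed (κ μ : Fin 2) : PDO B := 𝒟.Φ μ * del κ * (𝒟.Φ μ)⁻¹

/-- The inverse `Φ_μ ∂_κ⁻¹ Φ_μ⁻¹` of the dressed derivation. -/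
def dressedInv (κ μ : Fin 2) : PDO B := 𝒟.Φ μ * delInv κ * (𝒟.Φ μ)⁻¹

lemma conj_mul_conj (μ : Fin 2) (A C : PDO B) :
    𝒟.Φ μ * A * (𝒟.Φ μ)⁻¹ * (𝒟.Φ μ * C * (𝒟.Φ μ)⁻¹) = 𝒟.Φ μ * (A * C) * (𝒟.Φ μ)⁻¹ := by
  rw [show 𝒟.Φ μ * A * (𝒟.Φ μ)⁻¹ * (𝒟.Φ μ * C * (𝒟.Φ μ)⁻¹)
    = 𝒟.Φ μ * A * ((𝒟.Φ μ)⁻¹ * 𝒟.Φ μ) * C * (𝒟.Φ μ)⁻¹ by noncomm_ring, inv_mul_Φ, mul_one,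
    mul_assoc (𝒟.Φ μ) A C]

lemma dressed_mul_dressedInv (κ μ : Fin 2) : 𝒟.dressed κ μ * 𝒟.dressedInv κ μ = 1 := by
  rw [dressed, dressedInv, conj_mul_conj, del_mul_delInv, mul_one, Φ_mul_inv]

lemma del_mul_comm (κ ν : Fin 2) : (del κ * del ν : PDO B) = del ν * del κ := by
  rw [del, del, mono_one_mul_mono_one, mono_one_mul_mono_one, add_comm]

lemma commute_dressed (κ ν μ : Fin 2) : Commute (𝒟.dressed κ μ) (𝒟.dressed ν μ) := by
  rw [Commute, SemiconjBy, dressed, dressed, conj_mul_conj, conj_mul_conj, del_mul_comm]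

lemma dressed_sub_del (κ μ : Fin 2) :
    𝒟.dressed κ μ - del κ = 𝒟.Φ μ * mapCoeff (d κ) (𝒟.Φ μ)⁻¹ := by
  rw [← del_mul_sub, mul_sub, ← mul_assoc, ← mul_assoc, Φ_mul_inv, one_mul, dressed]

lemma isSingle_dressed_sub_del (κ μ : Fin 2) : (𝒟.dressed κ μ - del κ).IsSingle μ := by
  rw [dressed_sub_del]
  exact (𝒟.isSingle_Φ μ).mul fun α hα => 𝒟.isSingle_inv_Φ μ α (coeff_mapCoeff_ne_zero hα)

lemma dressed_sub_del_mem_ordLE (κ μ : Fin 2) : 𝒟.dressed κ μ - del κ ∈ ordLE μ 0 := by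
  rw [dressed_sub_del]
  exact mul_mem_ordLE (𝒟.Φ_mem_ordLE μ) (mapCoeff_mem_ordLE _ (𝒟.inv_Φ_mem_ordLE μ))
    (zero_add 0).le

lemma dressed_mem_ordLE {κ μ : Fin 2} (h : κ ≠ μ) : 𝒟.dressed κ μ ∈ ordLE μ 0 := by
  rw [← sub_add_cancel (𝒟.dressed κ μ) (del κ)]
  exact add_mem (𝒟.dressed_sub_del_mem_ordLE κ μ) ((isSingle_del κ).ordLE h.symm)

lemma dressed_mem_ordGE {κ μ : Fin 2} (h : κ ≠ μ) : 𝒟.dressed κ μ ∈ ordGE κ 0 := by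
  rw [← sub_add_cancel (𝒟.dressed κ μ) (del κ)]
  exact add_mem ((𝒟.isSingle_dressed_sub_del κ μ).ordGE h) (del_mem_ordGE κ κ)

lemma dressedInv_mem_ordLE {κ μ : Fin 2} (h : κ ≠ μ) : 𝒟.dressedInv κ μ ∈ ordLE κ (-1) :=
  mul_mem_ordLE (mul_mem_ordLE ((𝒟.isSingle_Φ μ).ordLE h) (delInv_mem_ordLE κ) (zero_add _).le)
    ((𝒟.isSingle_inv_Φ μ).ordLE h) (add_zero _).le

/-- The pseudo-differential operator `P_ν = Φ_ν ∂_ν Φ_ν⁻¹`. -/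
def P (ν : Fin 2) : PDO B := 𝒟.Φ ν * del ν * (𝒟.Φ ν)⁻¹

/-- `(P_1^k)_{<0}` and `(P_2^k)_{<1}`. -/
def Pneg (ν : Fin 2) (k : ℕ) : PDO B := truncLT ν ((ν : ℕ) : ℤ) (𝒟.P ν ^ k)

/-- `(P_1^k)_{≥0}` and `(P_2^k)_{≥1}`. -/
def Ppos (ν : Fin 2) (k : ℕ) : PDO B := truncGE ν ((ν : ℕ) : ℤ) (𝒟.P ν ^ k)

lemma isSingle_P (ν : Fin 2) : (𝒟.P ν).IsSingle ν :=
  ((𝒟.isSingle_Φ ν).mul (isSingle_del ν)).mul (𝒟.isSingle_inv_Φ ν)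

lemma isSingle_P_pow (ν : Fin 2) (k : ℕ) : (𝒟.P ν ^ k).IsSingle ν := (𝒟.isSingle_P ν).pow k

lemma isSingle_Pneg (ν : Fin 2) (k : ℕ) : (𝒟.Pneg ν k).IsSingle ν :=
  (𝒟.isSingle_P_pow ν k).truncLT ν _

lemma isSingle_Ppos (ν : Fin 2) (k : ℕ) : (𝒟.Ppos ν k).IsSingle ν :=
  (𝒟.isSingle_P_pow ν k).truncGE ν _

lemma Pneg_mem_ordLE (ν : Fin 2) (k : ℕ) : 𝒟.Pneg ν k ∈ ordLE ν ((ν : ℕ) - 1) :=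
  truncLT_mem_ordLE ν _ _

lemma Ppos_mem_ordGE (ν : Fin 2) (k : ℕ) : 𝒟.Ppos ν k ∈ ordGE ν (ν : ℕ) :=
  truncGE_mem_ordGE ν _ _

lemma Ppos_mem_ordGE_zero (ν κ : Fin 2) (k : ℕ) : 𝒟.Ppos ν k ∈ ordGE κ 0 := by
  by_cases h : κ = ν
  · subst h; exact ordGE_anti (by simp) (𝒟.Ppos_mem_ordGE κ k)
  · exact (𝒟.isSingle_Ppos ν k).ordGE h

lemma Ppos_add_Pneg (ν : Fin 2) (k : ℕ) : 𝒟.Ppos ν k + 𝒟.Pneg ν k = 𝒟.P ν ^ k :=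
  truncGE_add_truncLT ν _ _

/-- The right-hand side of the evolutionary equation for `∂Φ_μ/∂t_{ν,k}`. -/
def flowRHS (ν : Fin 2) (k : ℕ) (μ : Fin 2) : PDO B :=
  if μ = ν then -𝒟.Pneg ν k * 𝒟.Φ μ else (𝒟.Ppos ν k).act (𝒟.Φ μ)

/-- The operator `B_{ν,k}^μ`. -/
def Bop (ν : Fin 2) (k : ℕ) (μ : Fin 2) : PDO B :=
  if μ = ν then -𝒟.Pneg ν k else (𝒟.Ppos ν k).act (𝒟.Φ μ) * (𝒟.Φ μ)⁻¹

lemma Bop_self (ν : Fin 2) (k : ℕ) : 𝒟.Bop ν k ν = -𝒟.Pneg ν k := if_pos rfl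

lemma Bop_of_ne {μ ν : Fin 2} (h : μ ≠ ν) (k : ℕ) :
    𝒟.Bop ν k μ = (𝒟.Ppos ν k).act (𝒟.Φ μ) * (𝒟.Φ μ)⁻¹ := if_neg h

lemma flowRHS_eq (ν : Fin 2) (k : ℕ) (μ : Fin 2) : 𝒟.flowRHS ν k μ = 𝒟.Bop ν k μ * 𝒟.Φ μ := by
  by_cases h : μ = ν
  · subst h; rw [flowRHS, if_pos rfl, Bop_self]
  · rw [flowRHS, if_neg h, Bop_of_ne _ h, mul_assoc, inv_mul_Φ, mul_one]

lemma isSingle_Bop (ν : Fin 2) (k : ℕ) (μ : Fin 2) : (𝒟.Bop ν k μ).IsSingle μ := by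
  by_cases h : μ = ν
  · subst h; rw [Bop_self]; exact (𝒟.isSingle_Pneg μ k).neg
  · rw [Bop_of_ne _ h]; exact ((𝒟.isSingle_Φ μ).act _).mul (𝒟.isSingle_inv_Φ μ)

lemma act_mem_ordLE (D : PDO B) {ν : Fin 2} {n : ℤ} {A : PDO B} (hA : A ∈ ordLE ν n) :
    D.act A ∈ ordLE ν n :=
  fun α hα => hA α fun h0 => hα (by simp [coeff_act, h0, dpow_zero_arg])

/-- `∂Φ₁/∂t_{2,k}` has negative order, since `(P₂^k)_{≥1}` annihilates constants. -/
lemma act_Φ_zero_mem_ordLE (k : ℕ) : (𝒟.Ppos 1 k).act (𝒟.Φ 0) ∈ ordLE 0 (-1) := fun α hα => by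
  have h0 : α 0 ≤ 0 := act_mem_ordLE _ (𝒟.Φ_mem_ordLE 0) α hα
  have h1 : α 1 = 0 := (𝒟.isSingle_Φ 0).act _ α hα 1 one_ne_zero
  by_contra hlt
  have hα0 : α = 0 := by
    ext i
    have hi : i = 0 ∨ i = 1 := by omega
    rcases hi with rfl | rfl
    · simp only [Pi.zero_apply]; omega
    · exact h1
  have hc : (𝒟.Φ 0).coeff 0 = 1 := by
    have := coeff_series_single 0 (𝒟.a 0) 0
    rwa [Nat.cast_zero, neg_zero, Pi.single_zero, 𝒟.a_zero] at this
  refine hα ?_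
  rw [hα0, coeff_act, hc]
  refine finsum_eq_zero_of_forall_eq_zero fun r => ?_
  by_cases hr : r = 0
  · subst hr
    rw [coeff_eq_zero_of_ordGE (𝒟.Ppos_mem_ordGE 1 k) (by simp), zero_mul]
  · rw [dpow_one r hr, mul_zero]

lemma Bop_mem_ordLE (ν : Fin 2) (k : ℕ) (μ : Fin 2) : 𝒟.Bop ν k μ ∈ ordLE μ ((μ : ℕ) - 1) := by
  by_cases h : μ = ν
  · subst h; rw [Bop_self]; exact neg_mem (𝒟.Pneg_mem_ordLE μ k)
  · rw [Bop_of_ne _ h]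
    refine mul_mem_ordLE (m := (μ : ℕ) - 1) ?_ (𝒟.inv_Φ_mem_ordLE μ) (add_zero _).le
    have hμ : μ = 0 ∨ μ = 1 := by omega
    rcases hμ with rfl | rfl
    · obtain rfl : ν = 1 := by omega
      exact 𝒟.act_Φ_zero_mem_ordLE k
    · exact act_mem_ordLE _ (𝒟.Φ_mem_ordLE 1)

lemma Bop_mem_ordLE_zero (ν : Fin 2) (k : ℕ) (μ : Fin 2) : 𝒟.Bop ν k μ ∈ ordLE μ 0 :=
  ordLE_mono (by omega) (𝒟.Bop_mem_ordLE ν k μ)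

lemma Bop_self_eq (ν : Fin 2) (k : ℕ) : 𝒟.Bop ν k ν = 𝒟.Ppos ν k - 𝒟.P ν ^ k := by
  rw [Bop_self, ← Ppos_add_Pneg]; abel

/-- For `μ ≠ ν`, the operator `B_{ν,k}^μ` differs from the differential operator `Ppos ν k` by a
left multiple of the dressed derivation `Φ_μ ∂_ν Φ_μ⁻¹`. -/
lemma exists_Bop_eq {μ ν : Fin 2} (h : μ ≠ ν) (k : ℕ) :
    ∃ Y ∈ ordGE ν 0, 𝒟.Bop ν k μ = 𝒟.Ppos ν k - Y * 𝒟.dressed ν μ := by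
  obtain ⟨X, hX, hX'⟩ := exists_mul_eq_act_add h (𝒟.isSingle_Ppos ν k)
    (𝒟.Ppos_mem_ordGE_zero ν ν k) (𝒟.isSingle_Φ μ)
  refine ⟨X * (𝒟.Φ μ)⁻¹, mul_mem_ordGE hX ((𝒟.isSingle_inv_Φ μ).ordGE h.symm), ?_⟩
  rw [Bop_of_ne _ h, eq_sub_iff_add_eq.2 hX'.symm, sub_mul, mul_assoc (𝒟.Ppos ν k), Φ_mul_inv,
    mul_one, dressed, show X * (𝒟.Φ μ)⁻¹ * (𝒟.Φ μ * del ν * (𝒟.Φ μ)⁻¹)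
      = X * ((𝒟.Φ μ)⁻¹ * 𝒟.Φ μ) * del ν * (𝒟.Φ μ)⁻¹ by noncomm_ring, inv_mul_Φ, mul_one]

end Generic

variable {B : Type*} [CommRing B] [Algebra ℂ B] [BiDifferential B]

/-! ### Flows within one series -/

/-- The expression `T X - T' Y + [X, Y]`, whose vanishing is the zero-curvature equation for the
evolutions `T` and `T'` with operators `Y` and `X`. -/
def curvature (T T' : Derivation ℂ B B) (X Y : PDO B) : PDO B :=
  mapCoeff T X - mapCoeff T' Y + (X * Y - Y * X)

lemma curvature_swap (T T' : Derivation ℂ B B) (X Y : PDO B) :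
    curvature T' T Y X = -curvature T T' X Y := by
  rw [curvature, curvature]; abel

lemma curvature_mem_ordLE (T T' : Derivation ℂ B B) {X Y : PDO B} {ν : Fin 2} {n : ℤ}
    (hX : X ∈ ordLE ν n) (hY : Y ∈ ordLE ν n) (hn : n ≤ 0) : curvature T T' X Y ∈ ordLE ν n :=
  add_mem (sub_mem (mapCoeff_mem_ordLE T hX) (mapCoeff_mem_ordLE T' hY))
    (sub_mem (mul_mem_ordLE hX hY (by omega)) (mul_mem_ordLE hY hX (by omega)))

lemma curvature_mem_ordGE (T T' : Derivation ℂ B B) {X Y : PDO B} {ν : Fin 2} {n : ℤ}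
    (hX : X ∈ ordGE ν n) (hY : Y ∈ ordGE ν n) (hn : 0 ≤ n) : curvature T T' X Y ∈ ordGE ν n :=
  add_mem (sub_mem (mapCoeff_mem_ordGE T hX) (mapCoeff_mem_ordGE T' hY))
    (sub_mem (mul_mem_ordGE (ordGE_anti hn hX) hY) (mul_mem_ordGE (ordGE_anti hn hY) hX))

lemma mapCoeff_pow {T : Derivation ℂ B B} (hT : ∀ κ f, T (d κ f) = d κ (T f)) {A X : PDO B}
    (h : mapCoeff T A = X * A - A * X) (k : ℕ) : mapCoeff T (A ^ k) = X * A ^ k - A ^ k * X := by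
  induction k with
  | zero => rw [pow_zero, mapCoeff_one, mul_one, one_mul, sub_self]
  | succ k ih => rw [pow_succ, mapCoeff_mul hT, ih, h]; noncomm_ring

omit [Algebra ℂ B] [BiDifferential B] in
/-- If `N` is a differential operator in `∂_ν` and has negative order in `∂_ν` modulo `I`, then
it vanishes modulo `I`. -/
lemma mem_coeffsIn_of_sub {I : Ideal B} {ν : Fin 2} {N A : PDO B} (hN : N ∈ ordGE ν 0)
    (hA : A ∈ ordLE ν (-1)) (h : N - A ∈ coeffsIn I) : N ∈ coeffsIn I := fun α => by
  by_cases hα : α ν < 0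
  · rw [coeff_eq_zero_of_ordGE hN hα]; exact I.zero_mem
  · have := h α
    rwa [coeff_sub, coeff_eq_zero_of_ordLE hA (by omega), sub_zero] at this

variable (𝒟 : Dressing B)

/-- `T` is the flow `∂/∂t_{ν,k}`, in terms of its action on the dressing operators. -/
structure IsFlow (ν : Fin 2) (k : ℕ) (T : Derivation ℂ B B) : Prop where
  comm : ∀ κ f, T (d κ f) = d κ (T f)
  evol : ∀ μ, mapCoeff T (𝒟.Φ μ) = 𝒟.Bop ν k μ * 𝒟.Φ μ

lemma commute_P_pow_dressed (κ ν : Fin 2) (k : ℕ) :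
    𝒟.P ν ^ k * 𝒟.dressed κ ν - 𝒟.dressed κ ν * 𝒟.P ν ^ k = 0 :=
  sub_eq_zero.2 ((𝒟.commute_dressed ν κ ν).pow_left k)

variable {𝒟}

namespace IsFlow

variable {μ ν : Fin 2} {k l : ℕ} {T T' : Derivation ℂ B B}

lemma mapCoeff_inv (hT : 𝒟.IsFlow ν k T) (μ : Fin 2) :
    mapCoeff T (𝒟.Φ μ)⁻¹ = -((𝒟.Φ μ)⁻¹ * 𝒟.Bop ν k μ) := by
  have h := mapCoeff_mul hT.comm (𝒟.Φ μ) (𝒟.Φ μ)⁻¹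
  rw [Φ_mul_inv, mapCoeff_one, hT.evol, mul_assoc, Φ_mul_inv, mul_one] at h
  have h' := congrArg (fun A => (𝒟.Φ μ)⁻¹ * A) h
  simp only [mul_zero, mul_add] at h'
  rw [← mul_assoc _ (𝒟.Φ μ), inv_mul_Φ, one_mul] at h'
  exact eq_neg_of_add_eq_zero_right h'.symm

lemma mapCoeff_dressed (hT : 𝒟.IsFlow ν k T) (κ μ : Fin 2) : mapCoeff T (𝒟.dressed κ μ)
    = 𝒟.Bop ν k μ * 𝒟.dressed κ μ - 𝒟.dressed κ μ * 𝒟.Bop ν k μ := by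
  rw [dressed, mapCoeff_mul hT.comm, mapCoeff_mul hT.comm, mapCoeff_del, hT.evol, hT.mapCoeff_inv]
  noncomm_ring

/-- The power `P_ν^k` commutes with `Φ_ν ∂_κ Φ_ν⁻¹` and may be dropped from `B_{ν,k}^ν`. -/
lemma mapCoeff_dressed_self (hT : 𝒟.IsFlow ν k T) (κ : Fin 2) : mapCoeff T (𝒟.dressed κ ν)
    = 𝒟.Ppos ν k * 𝒟.dressed κ ν - 𝒟.dressed κ ν * 𝒟.Ppos ν k := by
  have h := 𝒟.commute_P_pow_dressed κ ν k
  rw [hT.mapCoeff_dressed, Bop_self_eq, ← sub_eq_zero, ← neg_zero, ← h]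
  noncomm_ring

lemma mapCoeff_P_pow (hT : 𝒟.IsFlow ν k T) (μ : Fin 2) (l : ℕ) : mapCoeff T (𝒟.P μ ^ l)
    = 𝒟.Bop ν k μ * 𝒟.P μ ^ l - 𝒟.P μ ^ l * 𝒟.Bop ν k μ :=
  mapCoeff_pow hT.comm (hT.mapCoeff_dressed μ μ) l

/-- The classical argument for a single hierarchy: the curvatures of the positive and of the
negative parts of the powers of `P_ν` coincide, and hence both vanish. -/
lemma curvature_self (hT : 𝒟.IsFlow ν k T) (hT' : 𝒟.IsFlow ν l T') :
    curvature T T' (𝒟.Ppos ν l) (𝒟.Ppos ν k) = 0 ∧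
      curvature T T' (𝒟.Bop ν l ν) (𝒟.Bop ν k ν) = 0 := by
  have heq : curvature T T' (𝒟.Ppos ν l) (𝒟.Ppos ν k)
      = curvature T T' (𝒟.Bop ν l ν) (𝒟.Bop ν k ν) := by
    have h1 := hT.mapCoeff_P_pow ν l
    have h2 := hT'.mapCoeff_P_pow ν k
    have h3 : 𝒟.P ν ^ l * 𝒟.P ν ^ k - 𝒟.P ν ^ k * 𝒟.P ν ^ l = 0 := by
      rw [← pow_add, ← pow_add, add_comm, sub_self]
    have e1 : 𝒟.Ppos ν l = 𝒟.Bop ν l ν + 𝒟.P ν ^ l := by rw [Bop_self_eq, sub_add_cancel]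
    have e2 : 𝒟.Ppos ν k = 𝒟.Bop ν k ν + 𝒟.P ν ^ k := by rw [Bop_self_eq, sub_add_cancel]
    rw [curvature, curvature, e1, e2, mapCoeff_add, mapCoeff_add, h1, h2, ← sub_eq_zero, ← h3]
    noncomm_ring
  have h0 : curvature T T' (𝒟.Ppos ν l) (𝒟.Ppos ν k) = 0 := by
    refine eq_zero_of_ordLE_of_ordGE (ν := ν) (m := (ν : ℕ) - 1) (n := (ν : ℕ)) (by omega) ?_ ?_
    · rw [heq]
      exact curvature_mem_ordLE T T' (𝒟.Bop_mem_ordLE ν l ν) (𝒟.Bop_mem_ordLE ν k ν) (by omega)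
    · exact curvature_mem_ordGE T T' (𝒟.Ppos_mem_ordGE ν l) (𝒟.Ppos_mem_ordGE ν k) (by omega)
  exact ⟨h0, heq ▸ h0⟩

/-- Two flows of the same series, acting on the other dressing operator. Both operators are
congruent to differential operators modulo left multiples of `Φ_μ ∂_ν Φ_μ⁻¹`, and no nonzero
operator free of `∂_ν` is such a multiple. -/
lemma curvature_of_ne (hT : 𝒟.IsFlow ν k T) (hT' : 𝒟.IsFlow ν l T') (h : μ ≠ ν) :
    curvature T T' (𝒟.Bop ν l μ) (𝒟.Bop ν k μ) = 0 := by
  obtain ⟨Yk, hYk, ek⟩ := 𝒟.exists_Bop_eq h k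
  obtain ⟨Yl, hYl, el⟩ := 𝒟.exists_Bop_eq h l
  set V := -mapCoeff T Yl - Yl * 𝒟.Bop ν k μ + mapCoeff T' Yk + Yk * 𝒟.Bop ν l μ
    - 𝒟.Ppos ν l * Yk + 𝒟.Ppos ν k * Yl with hV
  have hZ : curvature T T' (𝒟.Bop ν l μ) (𝒟.Bop ν k μ) = V * 𝒟.dressed ν μ := by
    have h0 := (hT.curvature_self hT').1
    have h1 := hT.mapCoeff_dressed ν μ
    have h2 := hT'.mapCoeff_dressed ν μ
    rw [← sub_eq_zero, ← h0, hV, curvature, curvature, el, ek, mapCoeff_sub, mapCoeff_sub,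
      mapCoeff_mul hT.comm, mapCoeff_mul hT'.comm, h1, h2, ek, el]
    noncomm_ring
  have hBk : 𝒟.Bop ν k μ ∈ ordGE ν 0 := (𝒟.isSingle_Bop ν k μ).ordGE h.symm
  have hBl : 𝒟.Bop ν l μ ∈ ordGE ν 0 := (𝒟.isSingle_Bop ν l μ).ordGE h.symm
  have hVGE : V ∈ ordGE ν 0 := add_mem (sub_mem (add_mem (add_mem (sub_mem
    (neg_mem (mapCoeff_mem_ordGE T hYl)) (mul_mem_ordGE hYl hBk)) (mapCoeff_mem_ordGE T' hYk))
    (mul_mem_ordGE hYk hBl)) (mul_mem_ordGE (𝒟.Ppos_mem_ordGE_zero ν ν l) hYk))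
    (mul_mem_ordGE (𝒟.Ppos_mem_ordGE_zero ν ν k) hYl)
  have hVLE : V ∈ ordLE ν (-1) := by
    have : V = curvature T T' (𝒟.Bop ν l μ) (𝒟.Bop ν k μ) * 𝒟.dressedInv ν μ := by
      rw [hZ, mul_assoc, dressed_mul_dressedInv, mul_one]
    rw [this]
    exact mul_mem_ordLE (curvature_mem_ordLE T T' ((𝒟.isSingle_Bop ν l μ).ordLE h.symm)
      ((𝒟.isSingle_Bop ν k μ).ordLE h.symm) le_rfl) (𝒟.dressedInv_mem_ordLE h.symm) (zero_add _).le
  rw [hZ, eq_zero_of_ordLE_of_ordGE neg_one_lt_zero hVLE hVGE, zero_mul]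

end IsFlow

variable (𝒟)

/-! ### The constraint -/

/-- The operator `e^β ∂₁ e^{-β}`. -/
def L : PDO B := fn 𝒟.e * del 0 * fn 𝒟.e'

/-- The inverse of the operator `e^β ∂₁ e^{-β}`. -/
def Linv : PDO B := fn 𝒟.e * delInv 0 * fn 𝒟.e'

/-- The left-hand side `e^β ∂₁ e^{-β} Φ₁ ∂₂ Φ₁⁻¹` of the constraint. -/
def H₁ : PDO B := fn 𝒟.e * del 0 * fn 𝒟.e' * 𝒟.Φ 0 * del 1 * (𝒟.Φ 0)⁻¹

/-- The right-hand side `∂₂ Φ₂ ∂₁ Φ₂⁻¹` of the constraint. -/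
def H₂ : PDO B := del 1 * 𝒟.Φ 1 * del 0 * (𝒟.Φ 1)⁻¹

lemma H₁_eq : 𝒟.H₁ = 𝒟.L * 𝒟.dressed 1 0 := by
  rw [H₁, L, dressed]; noncomm_ring

lemma H₂_eq : 𝒟.H₂ = del 1 * 𝒟.dressed 0 1 := by
  rw [H₂, dressed]; noncomm_ring

/-- The inverse of the left-hand side of the constraint. -/
def H₁inv : PDO B := 𝒟.dressedInv 1 0 * 𝒟.Linv

/-- The inverse of the right-hand side of the constraint. -/
def H₂inv : PDO B := 𝒟.dressedInv 0 1 * delInv 1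

lemma L_mul_Linv : 𝒟.L * 𝒟.Linv = 1 := by
  rw [L, Linv, show fn 𝒟.e * del 0 * fn 𝒟.e' * (fn 𝒟.e * delInv 0 * fn 𝒟.e')
    = fn 𝒟.e * (del 0 * (fn 𝒟.e' * fn 𝒟.e) * delInv 0) * fn 𝒟.e' by noncomm_ring, fn_e'_mul,
    mul_one, del_mul_delInv, mul_one, fn_e_mul]

lemma Linv_mul_L : 𝒟.Linv * 𝒟.L = 1 := by
  rw [L, Linv, show fn 𝒟.e * delInv 0 * fn 𝒟.e' * (fn 𝒟.e * del 0 * fn 𝒟.e')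
    = fn 𝒟.e * (delInv 0 * (fn 𝒟.e' * fn 𝒟.e) * del 0) * fn 𝒟.e' by noncomm_ring, fn_e'_mul,
    mul_one, delInv_mul_del, mul_one, fn_e_mul]

lemma H₁_mul_H₁inv : 𝒟.H₁ * 𝒟.H₁inv = 1 := by
  rw [H₁_eq, H₁inv, mul_assoc, ← mul_assoc (𝒟.dressed 1 0), dressed_mul_dressedInv, one_mul,
    L_mul_Linv]

lemma H₂_mul_H₂inv : 𝒟.H₂ * 𝒟.H₂inv = 1 := by
  rw [H₂_eq, H₂inv, mul_assoc, ← mul_assoc (𝒟.dressed 0 1), dressed_mul_dressedInv, one_mul,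
    del_mul_delInv]

lemma isSingle_L : 𝒟.L.IsSingle 0 :=
  ((isSingle_fn _ 0).mul (isSingle_del 0)).mul (isSingle_fn _ 0)

lemma isSingle_Linv : 𝒟.Linv.IsSingle 0 :=
  ((isSingle_fn _ 0).mul (isSingle_delInv 0)).mul (isSingle_fn _ 0)

lemma L_mem_ordGE (ν : Fin 2) : 𝒟.L ∈ ordGE ν 0 :=
  mul_mem_ordGE (mul_mem_ordGE (fn_mem_ordGE _ ν) (del_mem_ordGE 0 ν)) (fn_mem_ordGE _ ν)

lemma L_mem_ordLE : 𝒟.L ∈ ordLE 0 1 :=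
  mul_mem_ordLE (mul_mem_ordLE (fn_mem_ordLE _ 0) (del_mem_ordLE 0) (zero_add _).le)
    (fn_mem_ordLE _ 0) (add_zero _).le

lemma H₁inv_mem_ordLE : 𝒟.H₁inv ∈ ordLE 1 (-1) :=
  mul_mem_ordLE (𝒟.dressedInv_mem_ordLE one_ne_zero) (𝒟.isSingle_Linv.ordLE one_ne_zero)
    (add_zero _).le

lemma H₂inv_mem_ordLE : 𝒟.H₂inv ∈ ordLE 0 (-1) :=
  mul_mem_ordLE (𝒟.dressedInv_mem_ordLE zero_ne_one) ((isSingle_delInv 1).ordLE zero_ne_one)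
    (add_zero _).le

lemma mapCoeff_L_mem_ordLE (T : Derivation ℂ B B) : mapCoeff T 𝒟.L ∈ ordLE 0 0 := by
  have h : 𝒟.L - del 0 = fn 𝒟.e * mapCoeff (d 0) (fn 𝒟.e') := by
    rw [← del_mul_sub, mul_sub, ← mul_assoc, ← mul_assoc, fn_e_mul, one_mul, L]
  have h' : 𝒟.L - del 0 ∈ ordLE 0 0 := by
    rw [h, mapCoeff_fn]
    exact mul_mem_ordLE (fn_mem_ordLE _ 0) (fn_mem_ordLE _ 0) (zero_add _).le
  have := mapCoeff_mem_ordLE T h'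
  rwa [mapCoeff_sub, mapCoeff_del, sub_zero] at this

/-- The function `e⁻¹ T(e) = T(β)`, as an operator. -/
def logDeriv (T : Derivation ℂ B B) : PDO B := fn (𝒟.e' * T 𝒟.e)

lemma mapCoeff_fn_e (T : Derivation ℂ B B) : mapCoeff T (fn 𝒟.e) = 𝒟.logDeriv T * fn 𝒟.e := by
  rw [mapCoeff_fn, logDeriv, fn_mul_fn]
  congr 1
  linear_combination (-T 𝒟.e) * 𝒟.e_mul_e'

lemma mapCoeff_fn_e' (T : Derivation ℂ B B) :
    mapCoeff T (fn 𝒟.e') = -(fn 𝒟.e' * 𝒟.logDeriv T) := by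
  have h : 𝒟.e * T 𝒟.e' + 𝒟.e' * T 𝒟.e = 0 := by
    have := congrArg T 𝒟.e_mul_e'
    rwa [Derivation.leibniz, Derivation.map_one_eq_zero, smul_eq_mul, smul_eq_mul] at this
  rw [mapCoeff_fn, logDeriv, fn_mul_fn]
  ext α
  rw [coeff_neg, coeff_fn, coeff_fn]
  split_ifs
  · linear_combination 𝒟.e' * h - T 𝒟.e' * 𝒟.e_mul_e'
  · rw [neg_zero]

lemma mapCoeff_L {T : Derivation ℂ B B} (hT : ∀ κ f, T (d κ f) = d κ (T f)) :
    mapCoeff T 𝒟.L = 𝒟.logDeriv T * 𝒟.L - 𝒟.L * 𝒟.logDeriv T := by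
  rw [L, mapCoeff_mul hT, mapCoeff_mul hT, mapCoeff_del, mapCoeff_fn_e, mapCoeff_fn_e']
  noncomm_ring

/-- `Φ₂ ∂₁ Φ₂⁻¹` and `e^β ∂₁ e^{-β}` differ by an operator of negative order in `∂₂`: the terms
of order one in `∂₂` of the two sides of the constraint cancel. -/
lemma dressed_sub_L_mem_ordLE : 𝒟.dressed 0 1 - 𝒟.L ∈ ordLE 1 (-1) := by
  have h : 𝒟.dressed 0 1 - 𝒟.L
      = ((𝒟.Φ 1 - fn 𝒟.e) * del 0 - 𝒟.L * (𝒟.Φ 1 - fn 𝒟.e)) * (𝒟.Φ 1)⁻¹ := by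
    have h1 : 𝒟.L * fn 𝒟.e = fn 𝒟.e * del 0 := by rw [L, mul_assoc, fn_e'_mul, mul_one]
    have h2 : (𝒟.Φ 1 - fn 𝒟.e) * del 0 - 𝒟.L * (𝒟.Φ 1 - fn 𝒟.e)
        = 𝒟.Φ 1 * del 0 - 𝒟.L * 𝒟.Φ 1 := by rw [sub_mul, mul_sub, h1]; abel
    rw [h2, sub_mul, mul_assoc 𝒟.L, Φ_mul_inv, mul_one, dressed]
  rw [h]
  have hL : 𝒟.L ∈ ordLE 1 0 := 𝒟.isSingle_L.ordLE one_ne_zero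
  exact mul_mem_ordLE (sub_mem
    (mul_mem_ordLE 𝒟.Φ_one_sub_mem_ordLE ((isSingle_del 0).ordLE one_ne_zero) (add_zero _).le)
    (mul_mem_ordLE hL 𝒟.Φ_one_sub_mem_ordLE (zero_add _).le)) (𝒟.inv_Φ_mem_ordLE 1) (add_zero _).le

variable {𝒟}

namespace IsFlow

variable {k l : ℕ} {T T' : Derivation ℂ B B} {I : Ideal B}

/-! ### Invariance of the constraint and commutation of the flows -/

/-- Since `T(e^β) = (P₁^k)_{≥0}(e^β)`, the differential operator `(P₁^k)_{≥0} - T(β)` annihilates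
`e^β`, so that it is divisible by `e^β ∂₁ e^{-β}`. -/
lemma exists_Ppos_eq (hT : 𝒟.IsFlow 0 k T) :
    ∃ W ∈ ordGE 0 0, 𝒟.Ppos 0 k = 𝒟.logDeriv T + W * 𝒟.L := by
  obtain ⟨X, hX, hX'⟩ := exists_mul_eq_act_add one_ne_zero (𝒟.isSingle_Ppos 0 k)
    (𝒟.Ppos_mem_ordGE_zero 0 0 k) (isSingle_fn 𝒟.e 1)
  have hΦ : (𝒟.Φ 1).coeff 0 = 𝒟.e := by
    have := coeff_series_single 1 (𝒟.a 1) 0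
    rw [Nat.cast_zero, neg_zero, Pi.single_zero] at this
    rw [Φ_one, coeff_fn_mul, this, 𝒟.a_zero, mul_one]
  have hact : (𝒟.Ppos 0 k).act (fn 𝒟.e) = 𝒟.logDeriv T * fn 𝒟.e := by
    rw [← mapCoeff_fn_e, mapCoeff_fn]
    ext α
    by_cases hα : α = 0
    · have h1 : (mapCoeff T (𝒟.Φ 1)).coeff 0 = ((𝒟.Ppos 0 k).act (𝒟.Φ 1)).coeff 0 := by
        rw [hT.evol, ← flowRHS_eq, flowRHS, if_neg one_ne_zero]
      rw [coeff_mapCoeff, hΦ, coeff_act, hΦ] at h1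
      rw [hα, coeff_act, coeff_fn, coeff_fn, if_pos rfl, if_pos rfl, h1]
    · rw [coeff_act, coeff_fn, coeff_fn, if_neg hα, if_neg hα]
      exact finsum_eq_zero_of_forall_eq_zero fun r => by rw [dpow_zero_arg, mul_zero]
  refine ⟨X * fn 𝒟.e', mul_mem_ordGE hX (fn_mem_ordGE _ 0), ?_⟩
  have h : 𝒟.Ppos 0 k * fn 𝒟.e * fn 𝒟.e'
      = ((𝒟.Ppos 0 k).act (fn 𝒟.e) + X * del 0) * fn 𝒟.e' := by rw [hX']
  rw [hact, add_mul, mul_assoc, mul_assoc (𝒟.logDeriv T), fn_e_mul, mul_one, mul_one] at h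
  rw [h, L, show X * fn 𝒟.e' * (fn 𝒟.e * del 0 * fn 𝒟.e')
    = X * (fn 𝒟.e' * fn 𝒟.e) * del 0 * fn 𝒟.e' by noncomm_ring, fn_e'_mul, mul_one]

lemma mapCoeff_H₁ {ν : Fin 2} (hT : 𝒟.IsFlow ν k T) : mapCoeff T 𝒟.H₁
    = mapCoeff T 𝒟.L * 𝒟.dressed 1 0 + 𝒟.L * mapCoeff T (𝒟.dressed 1 0) := by
  rw [H₁_eq, mapCoeff_mul hT.comm]

lemma mapCoeff_H₂ {ν : Fin 2} (hT : 𝒟.IsFlow ν k T) :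
    mapCoeff T 𝒟.H₂ = del 1 * mapCoeff T (𝒟.dressed 0 1) := by
  rw [H₂_eq, mapCoeff_mul hT.comm, mapCoeff_del, zero_mul, zero_add]

/-- The flows of the first series preserve the constraint. -/
lemma mapCoeff_constraint_zero (hI : ∀ κ, ∀ f ∈ I, d κ f ∈ I) (hH : 𝒟.H₁ - 𝒟.H₂ ∈ coeffsIn I)
    (hT : 𝒟.IsFlow 0 k T) : mapCoeff T (𝒟.H₁ - 𝒟.H₂) ∈ coeffsIn I := by
  obtain ⟨W, hW, eW⟩ := hT.exists_Ppos_eq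
  obtain ⟨Y, hY, eY⟩ := 𝒟.exists_Bop_eq one_ne_zero k
  set D := 𝒟.Ppos 0 k with hD
  set b := 𝒟.logDeriv T with hb
  set S := 𝒟.dressed 0 1 with hS
  have hDGE : D ∈ ordGE 0 0 := 𝒟.Ppos_mem_ordGE_zero 0 0 k
  have hSGE : S ∈ ordGE 0 0 := 𝒟.dressed_mem_ordGE zero_ne_one
  have hdel : (del 1 : PDO B) ∈ ordGE 0 0 := del_mem_ordGE 1 0
  -- `T` acts on both sides of the constraint by `H ↦ M H - H D` with differential operators `M`
  set M₁ := b + 𝒟.L * W with hM₁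
  set M₂ := (del 1 * D - del 1 * Y * S + del 1 * S * Y) * delInv 1 with hM₂
  have e₁ : mapCoeff T 𝒟.H₁ = M₁ * 𝒟.H₁ - 𝒟.H₁ * D := by
    have h1 : mapCoeff T (𝒟.dressed 1 0) = D * 𝒟.dressed 1 0 - 𝒟.dressed 1 0 * D :=
      hT.mapCoeff_dressed_self 1
    have h2 : mapCoeff T 𝒟.L = b * 𝒟.L - 𝒟.L * b := 𝒟.mapCoeff_L hT.comm
    have h3 : W * 𝒟.L = D - b := by rw [eW, add_sub_cancel_left]
    have h4 : M₁ * (𝒟.L * 𝒟.dressed 1 0)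
        = b * 𝒟.L * 𝒟.dressed 1 0 + 𝒟.L * (W * 𝒟.L) * 𝒟.dressed 1 0 := by
      rw [hM₁]; noncomm_ring
    rw [hT.mapCoeff_H₁, h1, h2, H₁_eq, h4, h3]
    noncomm_ring
  have e₂ : mapCoeff T 𝒟.H₂ = M₂ * 𝒟.H₂ - 𝒟.H₂ * D := by
    rw [hT.mapCoeff_H₂, hT.mapCoeff_dressed, eY, H₂_eq, hM₂, ← hS, mul_assoc _ (delInv 1),
      ← mul_assoc (delInv 1), delInv_mul_del, one_mul]
    noncomm_ring
  have hN : M₁ - M₂ ∈ coeffsIn I := by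
    refine mem_coeffsIn_of_sub (ν := 0) (A := mapCoeff T (𝒟.H₁ - 𝒟.H₂) * 𝒟.H₂inv) ?_ ?_ ?_
    · refine sub_mem (add_mem (fn_mem_ordGE _ 0) (mul_mem_ordGE (𝒟.L_mem_ordGE 0) hW)) ?_
      exact mul_mem_ordGE (add_mem (sub_mem (mul_mem_ordGE hdel hDGE)
        (mul_mem_ordGE (mul_mem_ordGE hdel hY) hSGE))
        (mul_mem_ordGE (mul_mem_ordGE hdel hSGE) hY)) ((isSingle_delInv 1).ordGE zero_ne_one)
    · refine mul_mem_ordLE (m := 0) ?_ 𝒟.H₂inv_mem_ordLE (zero_add _).le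
      rw [mapCoeff_sub, hT.mapCoeff_H₁, hT.mapCoeff_H₂]
      refine sub_mem (add_mem (mul_mem_ordLE (𝒟.mapCoeff_L_mem_ordLE T)
        ((𝒟.dressed_mem_ordLE one_ne_zero)) (zero_add _).le) ?_) ?_
      · refine mul_mem_ordLE 𝒟.L_mem_ordLE (n := -1) ?_ (by norm_num)
        have hB : 𝒟.Bop 0 k 0 ∈ ordLE 0 (-1) := 𝒟.Bop_mem_ordLE 0 k 0
        have hQ := 𝒟.dressed_mem_ordLE (κ := 1) (μ := 0) one_ne_zero
        rw [hT.mapCoeff_dressed]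
        exact sub_mem (mul_mem_ordLE hB hQ (add_zero _).le) (mul_mem_ordLE hQ hB (zero_add _).le)
      · refine mul_mem_ordLE ((isSingle_del 1).ordLE zero_ne_one) (n := 0) ?_ (zero_add _).le
        have h := mapCoeff_mem_ordLE T ((𝒟.isSingle_dressed_sub_del 0 1).ordLE zero_ne_one)
        rwa [mapCoeff_sub, mapCoeff_del, sub_zero] at h
    · have : M₁ - M₂ - mapCoeff T (𝒟.H₁ - 𝒟.H₂) * 𝒟.H₂inv
          = ((𝒟.H₁ - 𝒟.H₂) * D - M₁ * (𝒟.H₁ - 𝒟.H₂)) * 𝒟.H₂inv := by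
        have h1 : M₁ - M₂ = (M₁ - M₂) * 𝒟.H₂ * 𝒟.H₂inv := by
          rw [mul_assoc, H₂_mul_H₂inv, mul_one]
        rw [h1, mapCoeff_sub, e₁, e₂, ← sub_mul]
        congr 1
        noncomm_ring
      rw [this]
      exact mul_mem_coeffsIn_right (sub_mem (mul_mem_coeffsIn_right hH _)
        (mul_mem_coeffsIn_left hI _ hH)) _
  have : mapCoeff T (𝒟.H₁ - 𝒟.H₂)
      = (M₁ - M₂) * 𝒟.H₂ + M₁ * (𝒟.H₁ - 𝒟.H₂) - (𝒟.H₁ - 𝒟.H₂) * D := by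
    rw [mapCoeff_sub, e₁, e₂]; noncomm_ring
  rw [this]
  exact sub_mem (add_mem (mul_mem_coeffsIn_right hN _) (mul_mem_coeffsIn_left hI _ hH))
    (mul_mem_coeffsIn_right hH _)

/-- The flows of the second series preserve the constraint. -/
lemma mapCoeff_constraint_one (hI : ∀ κ, ∀ f ∈ I, d κ f ∈ I) (hH : 𝒟.H₁ - 𝒟.H₂ ∈ coeffsIn I)
    (hT : 𝒟.IsFlow 1 k T) : mapCoeff T (𝒟.H₁ - 𝒟.H₂) ∈ coeffsIn I := by
  obtain ⟨Y, hY, eY⟩ := 𝒟.exists_Bop_eq zero_ne_one k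
  set D := 𝒟.Ppos 1 k with hD
  set b := 𝒟.logDeriv T with hb
  set Q := 𝒟.dressed 1 0 with hQ
  have hDGE : D ∈ ordGE 1 1 := 𝒟.Ppos_mem_ordGE 1 k
  have hDGE' : D ∈ ordGE 1 0 := 𝒟.Ppos_mem_ordGE_zero 1 1 k
  have hQGE : Q ∈ ordGE 1 0 := 𝒟.dressed_mem_ordGE one_ne_zero
  have hLGE : 𝒟.L ∈ ordGE 1 0 := 𝒟.L_mem_ordGE 1
  have hLiGE : 𝒟.Linv ∈ ordGE 1 0 := 𝒟.isSingle_Linv.ordGE one_ne_zero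
  have hbGE : b ∈ ordGE 1 0 := fn_mem_ordGE _ 1
  have hLLE : 𝒟.L ∈ ordLE 1 0 := 𝒟.isSingle_L.ordLE one_ne_zero
  set M₁ := b - 𝒟.L * b * 𝒟.Linv + 𝒟.L * (D - Y * Q) * 𝒟.Linv + 𝒟.L * Q * Y * 𝒟.Linv with hM₁
  set M₂ := del 1 * (D * delInv 1) with hM₂
  have e₁ : mapCoeff T 𝒟.H₁ = M₁ * 𝒟.H₁ - 𝒟.H₁ * D := by
    have h : M₁ * (𝒟.L * Q) = b * (𝒟.L * Q) + (-(𝒟.L * b) + 𝒟.L * (D - Y * Q) + 𝒟.L * Q * Y)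
        * (𝒟.Linv * 𝒟.L) * Q := by rw [hM₁]; noncomm_ring
    rw [hT.mapCoeff_H₁, hT.mapCoeff_dressed, eY, 𝒟.mapCoeff_L hT.comm, H₁_eq, ← hQ, ← hb, h,
      Linv_mul_L]
    noncomm_ring
  have e₂ : mapCoeff T 𝒟.H₂ = M₂ * 𝒟.H₂ - 𝒟.H₂ * D := by
    have h : M₂ * (del 1 * 𝒟.dressed 0 1) = del 1 * D * (delInv 1 * del 1) * 𝒟.dressed 0 1 := by
      rw [hM₂]; noncomm_ring
    rw [hT.mapCoeff_H₂, hT.mapCoeff_dressed_self, H₂_eq, h, delInv_mul_del]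
    noncomm_ring
  have hN : M₁ - M₂ ∈ coeffsIn I := by
    refine mem_coeffsIn_of_sub (ν := 1) (A := mapCoeff T (𝒟.H₁ - 𝒟.H₂) * 𝒟.H₁inv) ?_ ?_ ?_
    · refine sub_mem (add_mem (add_mem (sub_mem hbGE
        (mul_mem_ordGE (mul_mem_ordGE hLGE hbGE) hLiGE)) (mul_mem_ordGE (mul_mem_ordGE hLGE
          (sub_mem hDGE' (mul_mem_ordGE hY hQGE))) hLiGE)) (mul_mem_ordGE (mul_mem_ordGE
            (mul_mem_ordGE hLGE hQGE) hY) hLiGE)) ?_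
      exact mul_mem_ordGE (del_mem_ordGE 1 1) (mul_delInv_mem_ordGE hDGE)
    · refine mul_mem_ordLE (m := 0) ?_ 𝒟.H₁inv_mem_ordLE (zero_add _).le
      -- the terms of order one in `∂₂` cancel: both are `T(e^β ∂₁ e^{-β}) ∂₂`
      have h : mapCoeff T (𝒟.H₁ - 𝒟.H₂)
          = mapCoeff T 𝒟.L * (Q - del 1) + 𝒟.L * mapCoeff T Q
            - mapCoeff (d 1) (mapCoeff T 𝒟.L) - del 1 * mapCoeff T (𝒟.dressed 0 1 - 𝒟.L) := by
        rw [mapCoeff_sub, hT.mapCoeff_H₁, hT.mapCoeff_H₂, ← del_mul_sub, mapCoeff_sub]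
        noncomm_ring
      rw [h]
      refine sub_mem (sub_mem (add_mem ?_ ?_) ?_) ?_
      · exact mul_mem_ordLE (mapCoeff_mem_ordLE T hLLE)
          ((𝒟.isSingle_dressed_sub_del 1 0).ordLE one_ne_zero) (zero_add _).le
      · refine mul_mem_ordLE hLLE (n := 0) ?_ (zero_add _).le
        have h := mapCoeff_mem_ordLE T ((𝒟.isSingle_dressed_sub_del 1 0).ordLE one_ne_zero)
        rwa [mapCoeff_sub, mapCoeff_del, sub_zero] at h
      · exact mapCoeff_mem_ordLE _ (mapCoeff_mem_ordLE T hLLE)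
      · exact mul_mem_ordLE (del_mem_ordLE 1) (mapCoeff_mem_ordLE T 𝒟.dressed_sub_L_mem_ordLE)
          (by norm_num)
    · have : M₁ - M₂ - mapCoeff T (𝒟.H₁ - 𝒟.H₂) * 𝒟.H₁inv
          = ((𝒟.H₁ - 𝒟.H₂) * D - M₂ * (𝒟.H₁ - 𝒟.H₂)) * 𝒟.H₁inv := by
        have h1 : M₁ - M₂ = (M₁ - M₂) * 𝒟.H₁ * 𝒟.H₁inv := by
          rw [mul_assoc, H₁_mul_H₁inv, mul_one]
        rw [h1, mapCoeff_sub, e₁, e₂, ← sub_mul]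
        congr 1
        noncomm_ring
      rw [this]
      exact mul_mem_coeffsIn_right (sub_mem (mul_mem_coeffsIn_right hH _)
        (mul_mem_coeffsIn_left hI _ hH)) _
  have : mapCoeff T (𝒟.H₁ - 𝒟.H₂)
      = (M₁ - M₂) * 𝒟.H₁ + M₂ * (𝒟.H₁ - 𝒟.H₂) - (𝒟.H₁ - 𝒟.H₂) * D := by
    rw [mapCoeff_sub, e₁, e₂]; noncomm_ring
  rw [this]
  exact sub_mem (add_mem (mul_mem_coeffsIn_right hN _) (mul_mem_coeffsIn_left hI _ hH))
    (mul_mem_coeffsIn_right hH _)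

/-- A flow of each series. The curvatures `Z₀` and `Z₁` acting on `Φ₁` and `Φ₂` are congruent to
the same differential operator, `Z₀` modulo left multiples of `Φ₁ ∂₂ Φ₁⁻¹` and `Z₁` modulo left
multiples of `Φ₂ ∂₁ Φ₂⁻¹`. Under the constraint both are multiples of `H`, so that
`Z₀ - Z₁ = (U' - U) H` with `U'` free of negative powers of `∂₁` and `U` free of negative powers of
`∂₂`. As `Z₀ - Z₁` has order at most zero in both derivations, `U' - U` has negative order in both,
and hence vanishes. Finally, `Z₀` has only negative powers of `∂₁` and `Z₁` has no power of `∂₁`. -/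
lemma curvature_mixed (hI : ∀ κ, ∀ f ∈ I, d κ f ∈ I) (hH : 𝒟.H₁ - 𝒟.H₂ ∈ coeffsIn I)
    (hT : 𝒟.IsFlow 0 k T) (hT' : 𝒟.IsFlow 1 l T') (μ : Fin 2) :
    curvature T T' (𝒟.Bop 1 l μ) (𝒟.Bop 0 k μ) ∈ coeffsIn I := by
  obtain ⟨Y, hY, eY⟩ := 𝒟.exists_Bop_eq one_ne_zero k
  obtain ⟨Y', hY', eY'⟩ := 𝒟.exists_Bop_eq zero_ne_one l
  set D := 𝒟.Ppos 0 k with hD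
  set D' := 𝒟.Ppos 1 l with hD'
  set Q := 𝒟.dressed 1 0 with hQ
  set S := 𝒟.dressed 0 1 with hS
  set V := mapCoeff T' Y - (D' * Y - Y * D') with hV
  set V' := mapCoeff T Y' + (Y' * D - D * Y') with hV'
  have hVGE : V ∈ ordGE 0 0 := sub_mem (mapCoeff_mem_ordGE T' hY) (sub_mem
    (mul_mem_ordGE (𝒟.Ppos_mem_ordGE_zero 1 0 l) hY) (mul_mem_ordGE hY
      (𝒟.Ppos_mem_ordGE_zero 1 0 l)))
  have hVGE' : V' ∈ ordGE 1 0 := add_mem (mapCoeff_mem_ordGE T hY') (sub_mem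
    (mul_mem_ordGE hY' (𝒟.Ppos_mem_ordGE_zero 0 1 k)) (mul_mem_ordGE
      (𝒟.Ppos_mem_ordGE_zero 0 1 k) hY'))
  have z0 : curvature T T' (𝒟.Bop 1 l 0) (𝒟.Bop 0 k 0) = curvature T T' D' D - V' * Q := by
    have h1 : mapCoeff T Q = D * Q - Q * D := hT.mapCoeff_dressed_self 1
    have h2 := hT'.mapCoeff_P_pow 0 k
    have h3 : 𝒟.Bop 0 k 0 = D - 𝒟.P 0 ^ k := 𝒟.Bop_self_eq 0 k
    rw [eY'] at h2
    rw [curvature, curvature, h3, eY', mapCoeff_sub, mapCoeff_sub, mapCoeff_mul hT.comm, h1, h2,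
      hV']
    noncomm_ring
  have z1 : curvature T T' (𝒟.Bop 1 l 1) (𝒟.Bop 0 k 1) = curvature T T' D' D + V * S := by
    have h1 : mapCoeff T' S = D' * S - S * D' := hT'.mapCoeff_dressed_self 0
    have h2 := hT.mapCoeff_P_pow 1 l
    have h3 : 𝒟.Bop 1 l 1 = D' - 𝒟.P 1 ^ l := 𝒟.Bop_self_eq 1 l
    rw [eY] at h2
    rw [curvature, curvature, h3, eY, mapCoeff_sub, mapCoeff_sub, mapCoeff_mul hT'.comm, h1, h2, hV]
    noncomm_ring
  set Z₀ := curvature T T' (𝒟.Bop 1 l 0) (𝒟.Bop 0 k 0) with hZ₀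
  set Z₁ := curvature T T' (𝒟.Bop 1 l 1) (𝒟.Bop 0 k 1) with hZ₁
  have o00 : Z₀ ∈ ordLE 0 (-1) := curvature_mem_ordLE T T' (𝒟.Bop_mem_ordLE 1 l 0)
    (𝒟.Bop_mem_ordLE 0 k 0) (by norm_num)
  have o01 : Z₀ ∈ ordLE 1 0 := curvature_mem_ordLE T T' ((𝒟.isSingle_Bop 1 l 0).ordLE one_ne_zero)
    ((𝒟.isSingle_Bop 0 k 0).ordLE one_ne_zero) le_rfl
  have o11 : Z₁ ∈ ordLE 1 0 := curvature_mem_ordLE T T' (𝒟.Bop_mem_ordLE_zero 1 l 1)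
    (𝒟.Bop_mem_ordLE_zero 0 k 1) le_rfl
  have o10 : Z₁ ∈ ordLE 0 0 := curvature_mem_ordLE T T' ((𝒟.isSingle_Bop 1 l 1).ordLE zero_ne_one)
    ((𝒟.isSingle_Bop 0 k 1).ordLE zero_ne_one) le_rfl
  have o10' : Z₁ ∈ ordGE 0 0 := curvature_mem_ordGE T T' ((𝒟.isSingle_Bop 1 l 1).ordGE zero_ne_one)
    ((𝒟.isSingle_Bop 0 k 1).ordGE zero_ne_one) le_rfl
  set U := V' * 𝒟.Linv with hU
  set U' := -(V * delInv 1) with hU'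
  have hUGE : U ∈ ordGE 1 0 := mul_mem_ordGE hVGE' (𝒟.isSingle_Linv.ordGE one_ne_zero)
  have hUGE' : U' ∈ ordGE 0 0 :=
    neg_mem (mul_mem_ordGE hVGE ((isSingle_delInv 1).ordGE zero_ne_one))
  have hdiff : Z₀ - Z₁ = U' * 𝒟.H₂ - U * 𝒟.H₁ := by
    have h1 : U' * 𝒟.H₂ = -(V * (delInv 1 * del 1) * S) := by rw [hU', H₂_eq]; noncomm_ring
    have h2 : U * 𝒟.H₁ = V' * (𝒟.Linv * 𝒟.L) * Q := by rw [hU, H₁_eq]; noncomm_ring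
    rw [h1, h2, delInv_mul_del, Linv_mul_L, z0, z1]
    noncomm_ring
  have c0 : (U' - U) - (Z₀ - Z₁) * 𝒟.H₂inv ∈ coeffsIn I := by
    have : (U' - U) - (Z₀ - Z₁) * 𝒟.H₂inv = U * (𝒟.H₁ - 𝒟.H₂) * 𝒟.H₂inv := by
      have h1 : U' - U = (U' - U) * 𝒟.H₂ * 𝒟.H₂inv := by rw [mul_assoc, H₂_mul_H₂inv, mul_one]
      rw [h1, hdiff, ← sub_mul]
      congr 1
      noncomm_ring
    rw [this]
    exact mul_mem_coeffsIn_right (mul_mem_coeffsIn_left hI _ hH) _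
  have c1 : (U' - U) - (Z₀ - Z₁) * 𝒟.H₁inv ∈ coeffsIn I := by
    have : (U' - U) - (Z₀ - Z₁) * 𝒟.H₁inv = U' * (𝒟.H₁ - 𝒟.H₂) * 𝒟.H₁inv := by
      have h1 : U' - U = (U' - U) * 𝒟.H₁ * 𝒟.H₁inv := by rw [mul_assoc, H₁_mul_H₁inv, mul_one]
      rw [h1, hdiff, ← sub_mul]
      congr 1
      noncomm_ring
    rw [this]
    exact mul_mem_coeffsIn_right (mul_mem_coeffsIn_left hI _ hH) _
  have l0 : (Z₀ - Z₁) * 𝒟.H₂inv ∈ ordLE 0 (-1) :=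
    mul_mem_ordLE (sub_mem (ordLE_mono (by norm_num) o00) o10) 𝒟.H₂inv_mem_ordLE (zero_add _).le
  have l1 : (Z₀ - Z₁) * 𝒟.H₁inv ∈ ordLE 1 (-1) :=
    mul_mem_ordLE (sub_mem o01 o11) 𝒟.H₁inv_mem_ordLE (zero_add _).le
  have hUU : U' - U ∈ coeffsIn I := fun α => by
    by_cases h0 : 0 ≤ α 0
    · have := c0 α
      rwa [coeff_sub, coeff_eq_zero_of_ordLE l0 (by omega), sub_zero] at this
    by_cases h1 : 0 ≤ α 1
    · have := c1 α
      rwa [coeff_sub, coeff_eq_zero_of_ordLE l1 (by omega), sub_zero] at this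
    rw [coeff_sub, coeff_eq_zero_of_ordGE hUGE' (by omega),
      coeff_eq_zero_of_ordGE hUGE (by omega), sub_zero]
    exact I.zero_mem
  have hZZ : Z₀ - Z₁ ∈ coeffsIn I := by
    have : Z₀ - Z₁ = (U' - U) * 𝒟.H₂ - U * (𝒟.H₁ - 𝒟.H₂) := by rw [hdiff]; noncomm_ring
    rw [this]
    exact sub_mem (mul_mem_coeffsIn_right hUU _) (mul_mem_coeffsIn_left hI _ hH)
  have hZ0 : Z₀ ∈ coeffsIn I := fun α => by
    by_cases h0 : α 0 < 0
    · have := hZZ α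
      rwa [coeff_sub, coeff_eq_zero_of_ordGE o10' h0, sub_zero] at this
    · rw [coeff_eq_zero_of_ordLE o00 (by omega)]
      exact I.zero_mem
  have hμ : μ = 0 ∨ μ = 1 := by omega
  rcases hμ with rfl | rfl
  · exact hZ0
  · have : Z₁ = Z₀ - (Z₀ - Z₁) := by abel
    change Z₁ ∈ coeffsIn I
    rw [this]
    exact sub_mem hZ0 hZZ

/-- The zero-curvature equations hold under the constraint. -/
lemma curvature_mem {μ ν : Fin 2} (hI : ∀ κ, ∀ f ∈ I, d κ f ∈ I)
    (hH : 𝒟.H₁ - 𝒟.H₂ ∈ coeffsIn I) (hT : 𝒟.IsFlow μ k T) (hT' : 𝒟.IsFlow ν l T') (κ : Fin 2) :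
    curvature T T' (𝒟.Bop ν l κ) (𝒟.Bop μ k κ) ∈ coeffsIn I := by
  have h : μ = ν ∨ (μ = 0 ∧ ν = 1) ∨ (μ = 1 ∧ ν = 0) := by omega
  rcases h with rfl | ⟨rfl, rfl⟩ | ⟨rfl, rfl⟩
  · by_cases hκ : κ = μ
    · subst hκ
      rw [(hT.curvature_self hT').2]
      exact zero_mem _
    · rw [hT.curvature_of_ne hT' hκ]
      exact zero_mem _
  · exact curvature_mixed hI hH hT hT' κ
  · rw [curvature_swap]
    exact neg_mem (curvature_mixed hI hH hT' hT κ)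

/-- The flows preserve the constraint. -/
lemma mapCoeff_constraint {ν : Fin 2} (hI : ∀ κ, ∀ f ∈ I, d κ f ∈ I)
    (hH : 𝒟.H₁ - 𝒟.H₂ ∈ coeffsIn I) (hT : 𝒟.IsFlow ν k T) :
    mapCoeff T (𝒟.H₁ - 𝒟.H₂) ∈ coeffsIn I := by
  have hν : ν = 0 ∨ ν = 1 := by omega
  rcases hν with rfl | rfl
  · exact mapCoeff_constraint_zero hI hH hT
  · exact mapCoeff_constraint_one hI hH hT

/-- Two flows commute on the dressing operators under the constraint. -/
lemma mapCoeff_commutator_mem {μ ν : Fin 2} (hI : ∀ κ, ∀ f ∈ I, d κ f ∈ I)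
    (hH : 𝒟.H₁ - 𝒟.H₂ ∈ coeffsIn I) (hT : 𝒟.IsFlow μ k T) (hT' : 𝒟.IsFlow ν l T') (κ : Fin 2) :
    mapCoeff ⁅T, T'⁆ (𝒟.Φ κ) ∈ coeffsIn I := by
  have h1 : mapCoeff ⁅T, T'⁆ (𝒟.Φ κ)
      = mapCoeff T (mapCoeff T' (𝒟.Φ κ)) - mapCoeff T' (mapCoeff T (𝒟.Φ κ)) := by
    ext α
    rw [coeff_mapCoeff, Derivation.commutator_apply]
    exact (coeff_sub (mapCoeff T (mapCoeff T' (𝒟.Φ κ))) (mapCoeff T' (mapCoeff T (𝒟.Φ κ))) α).symm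
  have h2 : mapCoeff ⁅T, T'⁆ (𝒟.Φ κ)
      = curvature T T' (𝒟.Bop ν l κ) (𝒟.Bop μ k κ) * 𝒟.Φ κ := by
    rw [h1, hT'.evol, hT.evol, mapCoeff_mul hT.comm, mapCoeff_mul hT'.comm, hT'.evol, hT.evol,
      curvature]
    noncomm_ring
  rw [h2]
  exact mul_mem_coeffsIn_right (curvature_mem hI hH hT hT' κ) _

end IsFlow
end Dressing

/-! ### The hierarchy over the algebra of differential polynomials -/

lemma expβ_add (m n : ℤ) : expβ (m + n) = expβ m * expβ n := LaurentPolynomial.T_add m n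

lemma expβ_zero : expβ 0 = 1 := LaurentPolynomial.T_zero

lemma expβ_mul_expβ_neg : expβ 1 * expβ (-1) = 1 := by
  rw [← expβ_add, add_neg_cancel, expβ_zero]

lemma expβ_neg_mul_expβ : expβ (-1) * expβ 1 = 1 := by rw [mul_comm, expβ_mul_expβ_neg]

/-- The dressing operators of the KP-mKP hierarchy. -/
def jetDressing : Dressing JetAlg where
  e := expβ 1
  e' := expβ (-1)
  e_mul_e' := expβ_mul_expβ_neg
  a := aSeq
  a_zero _ := rfl

lemma Phi_eq (μ : Fin 2) : Phi μ = jetDressing.Φ μ := by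
  fin_cases μ <;> rfl

lemma P_eq (ν : Fin 2) : P ν = jetDressing.P ν :=
  congrArg (fun X : PDO JetAlg => X * del ν * X⁻¹) (Phi_eq ν)

lemma P_pow_eq (ν : Fin 2) (k : ℕ) : P ν ^ k = jetDressing.P ν ^ k :=
  congrArg (fun X : PDO JetAlg => X ^ k) (P_eq ν)

lemma Pneg_eq (ν : Fin 2) (k : ℕ) : Pneg ν k = jetDressing.Pneg ν k :=
  congrArg (truncLT ν ((ν : ℕ) : ℤ)) (P_pow_eq ν k)

lemma Ppos_eq (ν : Fin 2) (k : ℕ) : Ppos ν k = jetDressing.Ppos ν k :=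
  congrArg (truncGE ν ((ν : ℕ) : ℤ)) (P_pow_eq ν k)

lemma flowRHS_eq (ν : Fin 2) (k : ℕ) (μ : Fin 2) : flowRHS ν k μ = jetDressing.flowRHS ν k μ := by
  rw [flowRHS, Dressing.flowRHS, Pneg_eq, Ppos_eq, Phi_eq]

lemma Bop_eq (ν : Fin 2) (k : ℕ) (μ : Fin 2) : Bop ν k μ = jetDressing.Bop ν k μ := by
  rw [Bop, Dressing.Bop, Pneg_eq, Ppos_eq, Phi_eq]

lemma H₁_eq : H₁ = jetDressing.H₁ :=
  congrArg (fun X : PDO JetAlg => fn (expβ 1) * del 0 * fn (expβ (-1)) * X * del 1 * X⁻¹) (Phi_eq 0)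

lemma H₂_eq : H₂ = jetDressing.H₂ :=
  congrArg (fun X : PDO JetAlg => del 1 * X * del 0 * X⁻¹) (Phi_eq 1)

lemma IsFlow.dressing {ν : Fin 2} {k : ℕ} {T : Derivation ℂ JetAlg JetAlg} (hT : IsFlow ν k T) :
    jetDressing.IsFlow ν k T where
  comm := hT.comm
  evol μ := by rw [← Dressing.flowRHS_eq, ← flowRHS_eq, ← hT.evol, Phi_eq]

lemma coeff_Phi_zero (n : ℕ) : (Phi 0).coeff (Pi.single 0 (-(n : ℤ))) = aSeq 0 n :=
  Dressing.coeff_series_single 0 _ n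

lemma coeff_Phi_one (n : ℕ) :
    (Phi 1).coeff (Pi.single 1 (-(n : ℤ))) = expβ 1 * aSeq 1 n :=
  (coeff_fn_mul (expβ 1) (series 1 (aSeq 1)) _).trans
    (congrArg (expβ 1 * ·) (Dressing.coeff_series_single 1 _ n))

lemma jetD_iterate_jet (ν : Fin 2) (u : Unknown) (r : Fin 2 → ℕ) (n : ℕ) :
    (jetD ν)^[n] (jet u r) = jet u (r + Pi.single ν n) := by
  induction n with
  | zero => simp
  | succ n ih => rw [iterate_succ_apply', ih, jetD_jet, add_assoc, ← Pi.single_add]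

lemma jet_eq_dpow (u : Unknown) (r : Fin 2 → ℕ) : jet u r = dpow r (jet u 0) := by
  have h : dpow r (jet u 0) = (jetD 0)^[r 0] ((jetD 1)^[r 1] (jet u 0)) := rfl
  rw [h, jetD_iterate_jet, jetD_iterate_jet]
  congr 1
  ext i; fin_cases i <;> simp

lemma derivation_expβ {D : Derivation ℂ JetAlg JetAlg} (h : D (expβ 1) = expβ 1 * D betaFn)
    (n : ℤ) : D (expβ n) = n • (expβ n * D betaFn) := by
  have step (n : ℤ) : D (expβ (n + 1)) = expβ 1 * D (expβ n) + expβ (n + 1) * D betaFn := by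
    rw [expβ_add, Derivation.leibniz, h, smul_eq_mul, smul_eq_mul]; ring
  induction n with
  | zero => rw [expβ_zero, Derivation.map_one_eq_zero, zero_smul]
  | succ n ih => rw [step, ih, expβ_add]; simp only [zsmul_eq_mul]; push_cast; ring
  | pred n ih =>
    have h1 := step (-(n : ℤ) - 1)
    rw [sub_add_cancel, ih] at h1
    have h2 : expβ (-(n : ℤ) - 1) = expβ (-1) * expβ (-(n : ℤ)) := by
      rw [← expβ_add]; congr 1; ring
    have h3 : D (expβ (-(n : ℤ) - 1))
        = expβ (-1) * (expβ 1 * D (expβ (-(n : ℤ) - 1))) := by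
      rw [← mul_assoc, expβ_neg_mul_expβ, one_mul]
    rw [h3, ← sub_eq_iff_eq_add.2 h1, h2]
    simp only [zsmul_eq_mul]
    push_cast
    ring

/-- A derivation that kills the jets and the powers of `e^β` modulo an ideal is zero modulo that
ideal. -/
lemma derivation_mem {I : Ideal JetAlg} {D : Derivation ℂ JetAlg JetAlg}
    (hj : ∀ u r, D (jet u r) ∈ I) (he : ∀ n, D (expβ n) ∈ I) (f : JetAlg) : D f ∈ I := by
  have hC : ∀ p : JetPoly, D (LaurentPolynomial.C p) ∈ I := fun p => by
    induction p using MvPolynomial.induction_on with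
    | C z =>
      have : (LaurentPolynomial.C (MvPolynomial.C z) : JetAlg) = algebraMap ℂ JetAlg z := rfl
      rw [this, Derivation.map_algebraMap]
      exact I.zero_mem
    | add p q hp hq => rw [map_add, map_add]; exact I.add_mem hp hq
    | mul_X p x hp =>
      rw [map_mul, Derivation.leibniz]
      exact I.add_mem (I.mul_mem_left _ (hj x.1 x.2)) (I.mul_mem_left _ hp)
  induction f using LaurentPolynomial.induction_on' with
  | add f g hf hg => rw [map_add]; exact I.add_mem hf hg
  | C_mul_T n p =>
    rw [Derivation.leibniz]
    exact I.add_mem (I.mul_mem_left _ (he n)) (I.mul_mem_left _ (hC p))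

/-- The unknown functions are, up to units, coefficients of `Φ₁` and `Φ₂`: a derivation compatible
with the differential structure that kills `Φ₁` and `Φ₂` modulo a differential ideal is zero
modulo that ideal. -/
lemma derivation_mem_of_Phi {I : Ideal JetAlg} (hI : ∀ κ, ∀ f ∈ I, jetD κ f ∈ I)
    {D : Derivation ℂ JetAlg JetAlg} (hc : ∀ κ f, D (jetD κ f) = jetD κ (D f))
    (he : D (expβ 1) = expβ 1 * D betaFn) (hΦ : ∀ μ, mapCoeff D (Phi μ) ∈ coeffsIn I)
    (f : JetAlg) : D f ∈ I := by
  have cancel {g : JetAlg} (h : expβ 1 * g ∈ I) : g ∈ I := by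
    have := I.mul_mem_left (expβ (-1)) h
    rwa [← mul_assoc, expβ_neg_mul_expβ, one_mul] at this
  have h1 (n : ℕ) : D (expβ 1 * aSeq 1 n) ∈ I := by
    have := hΦ 1 (Pi.single 1 (-(n : ℤ)))
    rwa [coeff_mapCoeff, coeff_Phi_one] at this
  have hexp : D (expβ 1) ∈ I := by simpa [aSeq] using h1 0
  have hβ : D betaFn ∈ I := cancel (he ▸ hexp)
  have hu : ∀ u, D (jet u 0) ∈ I := by
    rintro (⟨μ, n⟩ | _)
    · fin_cases μ
      · have := hΦ 0 (Pi.single 0 (-((n + 1 : ℕ) : ℤ)))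
        rwa [coeff_mapCoeff, coeff_Phi_zero] at this
      · refine cancel ?_
        have := h1 (n + 1)
        rw [Derivation.leibniz] at this
        exact (I.add_mem_iff_left (I.mul_mem_left _ hexp)).1 this
    · exact hβ
  refine derivation_mem (fun u r => ?_) (fun n => ?_) f
  · rw [jet_eq_dpow, map_dpow hc]
    exact dpow_mem hI r (hu u)
  · rw [derivation_expβ he]
    exact zsmul_mem (I.mul_mem_left _ hβ) n

/-- The derivation commuting with `∂₁` and `∂₂` that maps each unknown function `u` to `g u`. -/
def evolution (g : Unknown → JetAlg) : Derivation ℂ JetAlg JetAlg :=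
  extend (MvPolynomial.mkDerivation ℂ fun x => dpow x.2 (g x.1)) (g Unknown.β)

lemma evolution_jet (g : Unknown → JetAlg) (u : Unknown) (r : Fin 2 → ℕ) :
    evolution g (jet u r) = dpow r (g u) := by
  have h := extend_C_mul_T (MvPolynomial.mkDerivation ℂ fun x => dpow x.2 (g x.1))
    (g Unknown.β) (MvPolynomial.X (u, r)) 0
  rw [LaurentPolynomial.T_zero, mul_one, MvPolynomial.mkDerivation_X, zero_smul, add_zero] at h
  exact h.trans (mul_one _)

lemma evolution_expβ (g : Unknown → JetAlg) (n : ℤ) :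
    evolution g (expβ n) = n • (g Unknown.β * expβ n) := by
  have h := extend_C_mul_T (MvPolynomial.mkDerivation ℂ fun x => dpow x.2 (g x.1))
    (g Unknown.β) 1 n
  rw [map_one, one_mul, Derivation.map_one_eq_zero, zero_add, mul_one, smul_mul_assoc] at h
  exact h

lemma jetD_dpow (κ : Fin 2) (r : Fin 2 → ℕ) (f : JetAlg) :
    jetD κ (dpow r f) = dpow (r + Pi.single κ 1) f := d_dpow κ r f

lemma evolution_comm (g : Unknown → JetAlg) (κ : Fin 2) (f : JetAlg) :
    evolution g (jetD κ f) = jetD κ (evolution g f) := by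
  have h : ⁅evolution g, jetD κ⁆ = 0 := by
    refine derivation_eq_zero _ (fun u r => ?_) fun n => ?_
    · rw [Derivation.commutator_apply, jetD_jet, evolution_jet, evolution_jet, jetD_dpow, sub_self]
    · have h1 : dpow (Pi.single κ 1) (g Unknown.β) = jetD κ (g Unknown.β) := by
        rw [← zero_add (Pi.single κ 1 : Fin 2 → ℕ), ← jetD_dpow, dpow_zero]
      rw [Derivation.commutator_apply, jetD_expβ, evolution_expβ, map_zsmul, map_zsmul,
        Derivation.leibniz, Derivation.leibniz, evolution_jet, evolution_expβ, jetD_expβ, h1]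
      simp only [smul_eq_mul, zsmul_eq_mul]
      ring
  have h' := congrArg (fun D : Derivation ℂ JetAlg JetAlg => D f) h
  simp only [Derivation.commutator_apply, Derivation.zero_apply] at h'
  exact sub_eq_zero.mp h'

/-- The images of the unknown functions under the derivation that maps `Φ₁` to `R 0` and `Φ₂` to
`R 1`. Since `Φ₂ = e^β (1 + ∑ a_{2,i} ∂₂^{-i})`, the image of `a_{2,i}` is obtained from the
coefficient of `R 1` by the product rule. -/
def velocity (R : Fin 2 → PDO JetAlg) : Unknown → JetAlg
  | .a 0 n => (R 0).coeff (Pi.single 0 (-((n + 1 : ℕ) : ℤ)))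
  | .a 1 n => expβ (-1) * (R 1).coeff (Pi.single 1 (-((n + 1 : ℕ) : ℤ)))
      - jet (.a 1 n) 0 * (expβ (-1) * (R 1).coeff 0)
  | .β => expβ (-1) * (R 1).coeff 0

/-- Evolutionary equations for `Φ₁` and `Φ₂` whose right-hand sides have the shape of `Φ₁ - 1` and
`Φ₂` have a solution. -/
lemma exists_evolution (R : Fin 2 → PDO JetAlg) (hs : ∀ μ, (R μ).IsSingle μ)
    (h0 : R 0 ∈ ordLE 0 (-1)) (h1 : R 1 ∈ ordLE 1 0) :
    ∃ T : Derivation ℂ JetAlg JetAlg, (∀ κ f, T (jetD κ f) = jetD κ (T f)) ∧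
      T (expβ 1) = expβ 1 * T betaFn ∧ ∀ μ, mapCoeff T (Phi μ) = R μ := by
  set g := velocity R with hg
  set gβ : JetAlg := expβ (-1) * (R 1).coeff 0 with hgβ
  have hβ : evolution g betaFn = gβ := evolution_jet g _ _
  have he : evolution g (expβ 1) = expβ 1 * gβ := by
    rw [evolution_expβ, one_smul, mul_comm]; rfl
  refine ⟨evolution g, evolution_comm g, by rw [he, hβ], fun μ => ?_⟩
  have hTs : (mapCoeff (evolution g) (Phi μ)).IsSingle μ :=
    fun α hα => by
      have h := coeff_mapCoeff_ne_zero hα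
      rw [Phi_eq] at h
      exact jetDressing.isSingle_Φ μ α h
  have hT0 : mapCoeff (evolution g) (Phi μ) ∈ ordLE μ 0 := by
    rw [Phi_eq]; exact mapCoeff_mem_ordLE _ (jetDressing.Φ_mem_ordLE μ)
  have hμ : μ = 0 ∨ μ = 1 := by omega
  rcases hμ with rfl | rfl
  · refine eq_of_isSingle_of_ordLE hTs (hs 0) hT0 (ordLE_mono (by norm_num) h0) fun i => ?_
    rw [zero_sub, coeff_mapCoeff, coeff_Phi_zero]
    cases i with
    | zero =>
      rw [aSeq, Derivation.map_one_eq_zero]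
      exact (coeff_eq_zero_of_ordLE h0 (by simp)).symm
    | succ n => exact evolution_jet g _ _
  · refine eq_of_isSingle_of_ordLE hTs (hs 1) hT0 h1 fun i => ?_
    rw [zero_sub, coeff_mapCoeff, coeff_Phi_one]
    cases i with
    | zero =>
      rw [aSeq, mul_one, he, hgβ, ← mul_assoc, expβ_mul_expβ_neg, one_mul, Nat.cast_zero, neg_zero,
        Pi.single_zero]
    | succ n =>
      have ha : evolution g (aSeq 1 (n + 1))
          = expβ (-1) * (R 1).coeff (Pi.single 1 (-((n + 1 : ℕ) : ℤ))) - aSeq 1 (n + 1) * gβ :=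
        evolution_jet g _ _
      rw [Derivation.leibniz, ha, he, smul_eq_mul, smul_eq_mul]
      linear_combination (R 1).coeff (Pi.single 1 (-((n + 1 : ℕ) : ℤ))) * expβ_mul_expβ_neg

/-! ### Existence of the flows and the constraint ideal -/

lemma existsUnique_flow (ν : Fin 2) (k : ℕ) :
    ∃! T : Derivation ℂ JetAlg JetAlg, IsFlow ν k T := by
  have hB (μ : Fin 2) : flowRHS ν k μ ∈ ordLE μ ((μ : ℕ) - 1) := by
    rw [flowRHS_eq, Dressing.flowRHS_eq]
    exact mul_mem_ordLE (jetDressing.Bop_mem_ordLE ν k μ) (jetDressing.Φ_mem_ordLE μ)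
      (add_zero _).le
  have hs (μ : Fin 2) : (flowRHS ν k μ).IsSingle μ := by
    rw [flowRHS_eq, Dressing.flowRHS_eq]
    exact (jetDressing.isSingle_Bop ν k μ).mul (jetDressing.isSingle_Φ μ)
  obtain ⟨T, h1, h2, h3⟩ := exists_evolution (flowRHS ν k) hs (hB 0) (hB 1)
  refine ⟨T, ⟨h1, h2, h3⟩, fun T' h' => ?_⟩
  refine Derivation.ext fun f => ?_
  have h := derivation_mem_of_Phi (I := ⊥) (D := T' - T) (fun κ f hf => by
    rw [Ideal.mem_bot] at hf ⊢; rw [hf, map_zero])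
    (fun κ f => by simp only [Derivation.sub_apply, h'.comm, h1, map_sub])
    (by simp only [Derivation.sub_apply, h'.exp, h2, mul_sub])
    (fun μ α => by
      have h4 : T ((Phi μ).coeff α) = T' ((Phi μ).coeff α) := by
        rw [← coeff_mapCoeff, ← coeff_mapCoeff, h3, h'.evol]
      rw [coeff_mapCoeff, Derivation.sub_apply, h4, sub_self]
      exact Ideal.zero_mem _) f
  exact sub_eq_zero.1 ((Ideal.mem_bot).1 h)

lemma jetD_mem_constraintIdeal (κ : Fin 2) (f : JetAlg) (hf : f ∈ constraintIdeal) :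
    jetD κ f ∈ constraintIdeal := by
  refine Submodule.span_induction ?_ ?_ ?_ ?_ hf
  · rintro _ ⟨r, α, rfl⟩
    rw [jetD_dpow]
    exact Ideal.subset_span ⟨_, α, rfl⟩
  · rw [map_zero]; exact Ideal.zero_mem _
  · intro f g _ _ hf hg
    rw [map_add]; exact Ideal.add_mem _ hf hg
  · intro c f hf' hf
    rw [smul_eq_mul, Derivation.leibniz]
    exact Ideal.add_mem _ (Ideal.mul_mem_left _ _ hf) (Ideal.mul_mem_right _ _ hf')

lemma constraint_mem : jetDressing.H₁ - jetDressing.H₂ ∈ coeffsIn constraintIdeal := fun α => by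
  rw [← H₁_eq, ← H₂_eq]
  exact Ideal.subset_span ⟨0, α, rfl⟩

lemma IsFlow.mem_constraintIdeal {ν : Fin 2} {k : ℕ} {T : Derivation ℂ JetAlg JetAlg}
    (hT : IsFlow ν k T) (f : JetAlg) (hf : f ∈ constraintIdeal) : T f ∈ constraintIdeal := by
  refine Submodule.span_induction ?_ ?_ ?_ ?_ hf
  · rintro _ ⟨r, α, rfl⟩
    rw [map_dpow hT.comm]
    refine dpow_mem jetD_mem_constraintIdeal r ?_
    have h := hT.dressing.mapCoeff_constraint jetD_mem_constraintIdeal constraint_mem α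
    rwa [← H₁_eq, ← H₂_eq] at h
  · rw [map_zero]; exact Ideal.zero_mem _
  · intro f g _ _ hf hg
    rw [map_add]; exact Ideal.add_mem _ hf hg
  · intro c f hf' hf
    rw [smul_eq_mul, Derivation.leibniz]
    exact Ideal.add_mem _ (Ideal.mul_mem_left _ _ hf) (Ideal.mul_mem_right _ _ hf')

lemma IsFlow.commutator_mem {μ ν : Fin 2} {k l : ℕ} {T T' : Derivation ℂ JetAlg JetAlg}
    (hT : IsFlow μ k T) (hT' : IsFlow ν l T') (f : JetAlg) :
    ⁅T, T'⁆ f ∈ constraintIdeal := by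
  refine derivation_mem_of_Phi jetD_mem_constraintIdeal (fun κ f => ?_) ?_ (fun κ => ?_) f
  · simp only [Derivation.commutator_apply, hT.comm, hT'.comm, map_sub]
  · simp only [Derivation.commutator_apply, hT.exp, hT'.exp, Derivation.leibniz, smul_eq_mul]
    ring
  · rw [Phi_eq]
    exact Dressing.IsFlow.mapCoeff_commutator_mem jetD_mem_constraintIdeal constraint_mem
      hT.dressing hT'.dressing κ

end KPmKP

end

theorem theorem3p1 :
    -- the operators and their truncations make sense
    (∀ ν : Fin 2, Phi ν * (Phi ν)⁻¹ = 1 ∧ (Phi ν)⁻¹ * Phi ν = 1) ∧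
    (∀ (ν : Fin 2) (k : ℕ), 1 ≤ k → (P ν ^ k).IsSingle ν) ∧
    -- the evolutionary equations define flows
    (∀ (ν : Fin 2) (k : ℕ), 1 ≤ k → ∃! T : Derivation ℂ JetAlg JetAlg, IsFlow ν k T) ∧
    -- the flows are compatible
    (∀ T : Fin 2 → ℕ → Derivation ℂ JetAlg JetAlg,
      (∀ (ν : Fin 2) (k : ℕ), 1 ≤ k → IsFlow ν k (T ν k)) →
      -- the constraint is preserved by every flow
      (∀ (ν : Fin 2) (k : ℕ), 1 ≤ k → ∀ f ∈ constraintIdeal, T ν k f ∈ constraintIdeal) ∧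
      -- the flows commute under the constraint
      (∀ (μ ν : Fin 2) (k l : ℕ), 1 ≤ k → 1 ≤ l → ∀ f : JetAlg,
        T μ k (T ν l f) - T ν l (T μ k f) ∈ constraintIdeal) ∧
      -- the zero-curvature equations hold under the constraint
      (∀ (κ μ ν : Fin 2) (k l : ℕ), 1 ≤ k → 1 ≤ l → ∀ α : Fin 2 → ℤ,
        (PDO.mapCoeff (T μ k) (Bop ν l κ) - PDO.mapCoeff (T ν l) (Bop μ k κ)
          + (Bop ν l κ * Bop μ k κ - Bop μ k κ * Bop ν l κ)).coeff α ∈ constraintIdeal)) := by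
  
  refine ⟨fun ν => ?_, fun ν k _ => ?_, fun ν k _ => existsUnique_flow ν k,
    fun T hT => ⟨?_, ?_, ?_⟩⟩
  · rw [Phi_eq]
    exact ⟨jetDressing.Φ_mul_inv ν, jetDressing.inv_mul_Φ ν⟩
  · rw [P_pow_eq]
    exact jetDressing.isSingle_P_pow ν k
  · exact fun ν k hk => (hT ν k hk).mem_constraintIdeal
  · exact fun μ ν k l hk hl => (hT μ k hk).commutator_mem (hT ν l hl)
  · intro κ μ ν k l hk hl α
    rw [Bop_eq, Bop_eq]
    exact Dressing.IsFlow.curvature_mem jetD_mem_constraintIdeal constraint_mem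
      (hT μ k hk).dressing (hT ν l hl).dressing κ α
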